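/- **Setting.** Let $\mathbb D$ be the open unit disc of $\mathbb C$ and let $\omega:[0,1)\to(0,\infty)$ be a continuous function with $\int_0^1\omega(r)\,dr=1$. Write $\widehat\omega(r)=\int_r^1\omega(s)\,ds$ and $\psi_\omega(r)=\widehat\omega(r)/\omega(r)$ for $0\le r<1$. Assume that $\omega$ is either *regular*, i.e. there is $C_0>0$ with $C_0^{-1}(1-r)\le\psi_\omega(r)\le C_0(1-r)$ for all $0\le r<1$, or *rapidly increasing*, i.e. $\lim_{r\to1^-}\psi_\omega(r)/(1-r)=\infty$. Let $0<p\le\infty$, $0<q<\infty$ and $0<\alpha<\infty$. For $f$ analytic in $\mathbb D$ and $0\le r<1$ let $M_p(r,f)=\left(\frac1{2\pi}\int_0^{2\pi}|f(re^{i\theta})|^p\,d\theta\right)^{1/p}$ if $p<\infty$, and $M_\infty(r,f)=\max_\theta|f(re^{i\theta})|$; put $$\|f\|^q_{H(p,q,\omega)}=\int_0^1M_p(r,f)^q\,\omega(r)\,dr\in[0,\infty],$$ and let $H(p,q,\omega)$ be the set of those analytic $f$ for which this is finite. For $n=0,1,2,\dots$ let $r_n\in[0,1)$ be the point with $\widehat\omega(r_n)=2^{-n\alpha}$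 and let $M_n$ be the integer part of $1/(1-r_n)$. Set $I(0)=\{k\in\mathbb N\cup\{0\}:k<M_1\}$ and $I(n)=\{k\in\mathbb N:M_n\le k<M_{n+1}\}$ for $n\ge1$. Given $\lambda>1$, let $f$ be an analytic function in $\mathbb D$ whose Maclaurin series is $f(z)=\sum_{k=0}^\infty a_kz^{n_k}$ with integers $1\le n_0<n_1<n_2<\cdots$ satisfying $$\frac{\widehat\omega\left(1-\frac1{n_k}\right)}{\widehat\omega\left(1-\frac1{n_{k+1}}\right)}\ge\lambda,\qquad k=0,1,2,\dots$$ (that is, $f$ is an $\omega$-lacunary series). **Theorem.** The following conditions are equivalent: 1. $f\in H(p,q,\omega)$; 2. $\displaystyle\sum_{n=0}^\infty2^{-n\alpha}\Big(\sum_{n_k\in I(n)}|a_k|^2\Big)^{q/2}<\infty$; 3. $\displaystyle\sum_{n=0}^\infty2^{-n\alpha}\sum_{n_k\in I(n)}|a_k|^q<\infty$; 4. $\displaystyle\sum_{n=0}^\infty2^{-n\alpha}\Big(\sum_{n_k\in I(n)}|a_k|\Big)^q<\infty$; 5. $\displaystyle\sum_{k=0}^\infty|a_k|^q\int_0^1r^{2n_k+1}\omega(r)\,dr<\infty$.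 Moreover, there is a constant $C>0$ depending only on $p,q,\alpha,\omega$ and $\lambda$ such that, for every such $f$, each of the four sums $S$ in (2)–(5) satisfies $C^{-1}S\le\|f\|^q_{H(p,q,\omega)}\le C\,S$ (as elements of $[0,\infty]$). -/

import Mathlib

open Set Filter Topology MeasureTheory
open scoped ENNReal

noncomputable section

namespace LacunaryMixedNorm

/-! ### Radial weights -/

/-- The tail `ω̂(r) = ∫_r^1 ω(s) ds` of a radial weight. -/
def tailIntegral (ω : ℝ → ℝ) (r : ℝ) : ℝ := ∫ s in r..1, ω s

/-- The distortion function `ψ_ω(r) = (1 / ω(r)) ∫_r^1 ω(s) ds`, `0 ≤ r < 1`. -/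
def distortion (ω : ℝ → ℝ) (r : ℝ) : ℝ := (1 / ω r) * tailIntegral ω r

/-- A continuous radial weight, given by its radial profile `ω : [0,1) → (0,∞)`; for a continuous
profile, integrability over the disc is the same as integrability over `[0,1)`. -/
structure IsContinuousRadialWeight (ω : ℝ → ℝ) : Prop where
  continuousOn : ContinuousOn ω (Ico 0 1)
  pos : ∀ r ∈ Ico (0 : ℝ) 1, 0 < ω r
  integrableOn : IntegrableOn ω (Ico 0 1)

/-- The class of regular weights: `ψ_ω(r) ≍ 1 - r` for `0 ≤ r < 1`. -/
def IsRegularWeight (ω : ℝ → ℝ) : Prop :=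
  IsContinuousRadialWeight ω ∧
    ∃ C : ℝ, 0 < C ∧ ∀ r ∈ Ico (0 : ℝ) 1,
      distortion ω r ≤ C * (1 - r) ∧ 1 - r ≤ C * distortion ω r

/-- The class of rapidly increasing weights: `ψ_ω(r) / (1 - r) → ∞` as `r → 1⁻`. -/
def IsRapidlyIncreasingWeight (ω : ℝ → ℝ) : Prop :=
  IsContinuousRadialWeight ω ∧
    Tendsto (fun r : ℝ => distortion ω r / (1 - r)) (𝓝[<] 1) atTop

/-! ### Mixed norm spaces -/

/-- The integral mean `M_p(r,f)`, `0 < p ≤ ∞`, with values in `[0,∞]`: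
`((1/2π) ∫_0^{2π} |f(re^{iθ})|^p dθ)^{1/p}` for finite `p`, and `max_θ |f(re^{iθ})|` for `p = ∞`. -/
def integralMean (p : ℝ≥0∞) (r : ℝ) (f : ℂ → ℂ) : ℝ≥0∞ :=
  if p = ∞ then ⨆ θ ∈ Icc (0 : ℝ) (2 * Real.pi), ‖f (circleMap 0 r θ)‖ₑ
  else (ENNReal.ofReal (1 / (2 * Real.pi)) *
    ∫⁻ θ in Icc (0 : ℝ) (2 * Real.pi), ‖f (circleMap 0 r θ)‖ₑ ^ p.toReal) ^ (1 / p.toReal)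

/-- The `q`-th power of the mixed norm, `‖f‖^q_{H(p,q,ω)} = ∫_0^1 M_p(r,f)^q ω(r) dr`,
with values in `[0,∞]`. -/
def mixedNormPow (p : ℝ≥0∞) (q : ℝ) (ω : ℝ → ℝ) (f : ℂ → ℂ) : ℝ≥0∞ :=
  ∫⁻ r in Ioo (0 : ℝ) 1, integralMean p r f ^ q * ENNReal.ofReal (ω r)

/-- `f ∈ H(p,q,ω)`. -/
def MemMixedNorm (p : ℝ≥0∞) (q : ℝ) (ω : ℝ → ℝ) (f : ℂ → ℂ) : Prop :=
  DifferentiableOn ℂ f (Metric.ball 0 1) ∧ mixedNormPow p q ω f < ∞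

/-! ### Blocks of indices -/

/-- The point `r_n = r_n(ω,α) ∈ [0,1)` with `ω̂(r_n) = 2^{-nα}`. -/
def blockRadius (ω : ℝ → ℝ) (α : ℝ) (n : ℕ) : ℝ :=
  Function.invFunOn (tailIntegral ω) (Ico (0 : ℝ) 1) ((2 : ℝ) ^ (-(n * α)))

/-- `M_n`, the integer part of `1 / (1 - r_n)`. -/
def blockStart (ω : ℝ → ℝ) (α : ℝ) (n : ℕ) : ℕ := ⌊1 / (1 - blockRadius ω α n)⌋₊

/-- The block `I_{ω,α}(n)`: `{k : k < M_1}` for `n = 0` and `{k : M_n ≤ k < M_{n+1}}` for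
`n ≥ 1`. -/
def block (ω : ℝ → ℝ) (α : ℝ) : ℕ → Set ℕ
  | 0 => {k | k < blockStart ω α 1}
  | n + 1 => {k | blockStart ω α (n + 1) ≤ k ∧ k < blockStart ω α (n + 2)}

/-! ### Lacunary series -/

/-- `f` is analytic in the unit disc with Maclaurin series `∑ a_k z^{n_k}`, where
`1 ≤ n_0 < n_1 < ⋯` and `ω̂(1 - 1/n_k) / ω̂(1 - 1/n_{k+1}) ≥ lam` for all `k`. The function `f` is
an `ω`-lacunary series if this holds for some `lam > 1`. -/
structure IsLacunarySeries (ω : ℝ → ℝ) (lam : ℝ) (f : ℂ → ℂ) (a : ℕ → ℂ) (n : ℕ → ℕ) : Prop where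
  differentiableOn : DifferentiableOn ℂ f (Metric.ball 0 1)
  hasSum : ∀ z ∈ Metric.ball (0 : ℂ) 1, HasSum (fun k => a k * z ^ n k) (f z)
  one_le : ∀ k, 1 ≤ n k
  strictMono : StrictMono n
  ratio : ∀ k, lam ≤ tailIntegral ω (1 - 1 / (n k : ℝ)) / tailIntegral ω (1 - 1 / (n (k + 1) : ℝ))

/-- `∑_m 2^{-mα} (∑_{n_k ∈ I(m)} |a_k|^s)^t`, with values in `[0,∞]`. -/
def blockSum (ω : ℝ → ℝ) (α : ℝ) (a : ℕ → ℂ) (n : ℕ → ℕ) (s t : ℝ) : ℝ≥0∞ :=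
  ∑' m : ℕ, ENNReal.ofReal ((2 : ℝ) ^ (-(m * α))) *
    (∑' k : {k : ℕ // n k ∈ block ω α m}, ‖a k‖ₑ ^ s) ^ t

/-- `∑_k |a_k|^q ∫_0^1 r^{2 n_k + 1} ω(r) dr`, with values in `[0,∞]`. -/
def momentSum (ω : ℝ → ℝ) (a : ℕ → ℂ) (n : ℕ → ℕ) (q : ℝ) : ℝ≥0∞ :=
  ∑' k : ℕ, ‖a k‖ₑ ^ q * ENNReal.ofReal (∫ r in (0 : ℝ)..1, r ^ (2 * n k + 1) * ω r)

/-- `A ≤ C B` and `B ≤ C A`, for quantities in `[0,∞]` and a finite constant `C`. -/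
def ComparableWith (C : ℝ) (A B : ℝ≥0∞) : Prop :=
  A ≤ ENNReal.ofReal C * B ∧ B ≤ ENNReal.ofReal C * A

/-! ### The points `r_n` are well defined -/

lemma IsContinuousRadialWeight.intervalIntegrable {ω : ℝ → ℝ} (h : IsContinuousRadialWeight ω)
    {x y : ℝ} (hx : x ∈ Icc (0 : ℝ) 1) (hy : y ∈ Icc (0 : ℝ) 1) :
    IntervalIntegrable ω volume x y := by
  have h01 : IntervalIntegrable ω volume 0 1 := by
    rw [intervalIntegrable_iff_integrableOn_Ico_of_le zero_le_one]
    exact h.integrableOn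
  refine h01.mono_set ?_
  rw [uIcc_of_le (zero_le_one' ℝ)]
  exact uIcc_subset_Icc hx hy

lemma IsContinuousRadialWeight.strictAntiOn_tailIntegral {ω : ℝ → ℝ}
    (h : IsContinuousRadialWeight ω) : StrictAntiOn (tailIntegral ω) (Icc 0 1) := by
  intro x hx y hy hxy
  have h1 := intervalIntegral.integral_add_adjacent_intervals
    (h.intervalIntegrable hx hy) (h.intervalIntegrable hy (right_mem_Icc.2 zero_le_one))
  have h2 : 0 < ∫ s in x..y, ω s :=
    intervalIntegral.intervalIntegral_pos_of_pos_on (h.intervalIntegrable hx hy)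
      (fun s hs => h.pos s ⟨hx.1.trans hs.1.le, hs.2.trans_le hy.2⟩) hxy
  unfold tailIntegral
  linarith

lemma IsContinuousRadialWeight.continuousOn_tailIntegral {ω : ℝ → ℝ}
    (h : IsContinuousRadialWeight ω) : ContinuousOn (tailIntegral ω) (Icc 0 1) := by
  have h01 := h.intervalIntegrable (left_mem_Icc.2 zero_le_one) (right_mem_Icc.2 zero_le_one)
  have hI : IntegrableOn ω (uIcc 1 0) := by
    rw [uIcc_comm, uIcc_of_le (zero_le_one' ℝ), integrableOn_Icc_iff_integrableOn_Ico]
    exact h.integrableOn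
  have := intervalIntegral.continuousOn_primitive_interval hI
  rw [uIcc_comm, uIcc_of_le (zero_le_one' ℝ)] at this
  refine this.neg.congr fun x _ => ?_
  simp only [tailIntegral, Pi.neg_apply]
  exact intervalIntegral.integral_symm _ _

/-- `r_n` is the unique point of `[0,1)` with `ω̂(r_n) = 2^{-nα}`. -/
theorem blockRadius_spec {ω : ℝ → ℝ} (h : IsContinuousRadialWeight ω)
    (h1 : ∫ r in (0 : ℝ)..1, ω r = 1) {α : ℝ} (hα : 0 < α) (n : ℕ) :
    (blockRadius ω α n ∈ Ico (0 : ℝ) 1 ∧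
      tailIntegral ω (blockRadius ω α n) = (2 : ℝ) ^ (-(n * α))) ∧
    ∀ r ∈ Ico (0 : ℝ) 1, tailIntegral ω r = (2 : ℝ) ^ (-(n * α)) → r = blockRadius ω α n := by
  have hpos : (0 : ℝ) < (2 : ℝ) ^ (-(n * α)) := by positivity
  have hle : (2 : ℝ) ^ (-(n * α)) ≤ 1 :=
    Real.rpow_le_one_of_one_le_of_nonpos one_le_two (by simp only [Left.neg_nonpos_iff]; positivity)
  have ht1 : tailIntegral ω 1 = 0 := by simp [tailIntegral]
  have hex : ∃ r ∈ Ico (0 : ℝ) 1, tailIntegral ω r = (2 : ℝ) ^ (-(n * α)) := by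
    obtain ⟨r, hr, hr'⟩ := intermediate_value_Icc' zero_le_one h.continuousOn_tailIntegral
      (show (2 : ℝ) ^ (-(n * α)) ∈ Icc (tailIntegral ω 1) (tailIntegral ω 0) from
        ⟨by rw [ht1]; exact hpos.le, by rw [tailIntegral, h1]; exact hle⟩)
    refine ⟨r, ⟨hr.1, lt_of_le_of_ne hr.2 ?_⟩, hr'⟩
    rintro rfl
    linarith
  have hm : blockRadius ω α n ∈ Ico (0 : ℝ) 1 := Function.invFunOn_mem hex
  have he : tailIntegral ω (blockRadius ω α n) = (2 : ℝ) ^ (-(n * α)) := Function.invFunOn_eq hex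
  refine ⟨⟨hm, he⟩, fun r hr hr' => ?_⟩
  exact h.strictAntiOn_tailIntegral.injOn (Ico_subset_Icc_self hr) (Ico_subset_Icc_self hm)
    (hr'.trans he.symm)

end LacunaryMixedNorm

end

open scoped ENNReal

noncomputable section

namespace LacunaryMixedNorm

/-! Every quantity is compared with one sum, `tailSum` = ∑ |a_k|^q ω̂(s_k), where s_k = 1 - 1/n_k.
The only property of ω needed is (1 - r) ω(r) ≤ β ω̂(r), which both classes have; it makes ω̂(r) (1
- r)^(-β) increasing, so ω̂ is doubling in 1 - r.

Norm ≲ `tailSum`: |f| ≤ ∑ |a_k| r^{n_k} whatever θ is, so p plays no role. By doubling, r^{n_k} is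
at most a constant times the 1/q-th power of a kernel of ω-integral ≲ ω̂(s_k), times a power of
min(ω̂(s_k)/ω̂(r), ω̂(r)/ω̂(s_k)). Lacunarity says that ω̂(s_k) decreases geometrically, so the last
factors have a sum over k bounded uniformly in r (`exists_tsum_rpow_le`).

`tailSum` ≲ norm: doubling and lacunarity leave boundedly many exponents in [M/2, M], hence
boundedly many solutions of n_i + n_j = M. Parseval for f² then bounds the fourth moment of f on a
circle by the square of its second moment, and Paley–Zygmund gives M_p(r,f) ≳ |a_k| r^{n_k} for
every p (`exists_coeff_le_integralMean`). Integrating the k-th bound over essentially (s_k,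
s_{k+1}), where r^{n_k} is bounded below and the ω-mass is comparable to ω̂(s_k), costs nothing in
the sum because these intervals are disjoint.

Block sums: ω̂(1 - 1/n) ≍ 2^{-mα} for n in I(m), so a block holds boundedly many exponents, and on
boundedly many terms all ℓ^s quasinorms agree up to constants. Moments: ∫ r^{2n+1} ω ≍ ω̂(1 - 1/n).
-/

/-! ### Tail integrals, and the reduction of both weight classes to a doubling condition -/

lemma tailIntegral_one (ω : ℝ → ℝ) : tailIntegral ω 1 = 0 := by simp [tailIntegral]

lemma IsContinuousRadialWeight.tailIntegral_pos {ω : ℝ → ℝ} (h : IsContinuousRadialWeight ω)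
    {r : ℝ} (hr : r ∈ Ico (0 : ℝ) 1) : 0 < tailIntegral ω r := by
  have := h.strictAntiOn_tailIntegral (Ico_subset_Icc_self hr) (right_mem_Icc.2 zero_le_one) hr.2
  rwa [tailIntegral_one] at this

lemma IsContinuousRadialWeight.tailIntegral_nonneg {ω : ℝ → ℝ} (h : IsContinuousRadialWeight ω)
    {r : ℝ} (hr : r ∈ Icc (0 : ℝ) 1) : 0 ≤ tailIntegral ω r := by
  have := h.strictAntiOn_tailIntegral.antitoneOn hr (right_mem_Icc.2 zero_le_one) hr.2
  rwa [tailIntegral_one] at this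

lemma IsContinuousRadialWeight.hasDerivAt_tailIntegral {ω : ℝ → ℝ}
    (h : IsContinuousRadialWeight ω) {r : ℝ} (hr : r ∈ Ioo (0 : ℝ) 1) :
    HasDerivAt (tailIntegral ω) (-ω r) r := by
  have hc : ContinuousAt ω r := h.continuousOn.continuousAt (Ico_mem_nhds hr.1 hr.2)
  refine intervalIntegral.integral_hasDerivAt_left
    (h.intervalIntegrable ⟨hr.1.le, hr.2.le⟩ (right_mem_Icc.2 zero_le_one)) ?_ hc
  exact (h.continuousOn.mono Ioo_subset_Ico_self).stronglyMeasurableAtFilter isOpen_Ioo r hr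

/-- The `ω`-mass of `(a, b)` is the decrement of the tail integral. -/
lemma IsContinuousRadialWeight.lintegral_Ioo {ω : ℝ → ℝ} (h : IsContinuousRadialWeight ω)
    {a b : ℝ} (ha : 0 ≤ a) (hab : a ≤ b) (hb : b ≤ 1) :
    ∫⁻ r in Ioo a b, ENNReal.ofReal (ω r) =
      ENNReal.ofReal (tailIntegral ω a - tailIntegral ω b) := by
  have haI : a ∈ Icc (0 : ℝ) 1 := ⟨ha, hab.trans hb⟩
  have hbI : b ∈ Icc (0 : ℝ) 1 := ⟨ha.trans hab, hb⟩
  have hI := h.intervalIntegrable haI hbI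
  have h2 : tailIntegral ω a - tailIntegral ω b = ∫ s in Ioo a b, ω s := by
    rw [← integral_Ioc_eq_integral_Ioo, ← intervalIntegral.integral_of_le hab]
    have h1 := intervalIntegral.integral_add_adjacent_intervals hI
      (h.intervalIntegrable hbI (right_mem_Icc.2 zero_le_one))
    unfold tailIntegral
    linarith
  rw [h2, ofReal_integral_eq_lintegral_ofReal]
  · rw [intervalIntegrable_iff_integrableOn_Ioo_of_le hab] at hI
    exact hI
  · filter_upwards [ae_restrict_mem measurableSet_Ioo] with s hs
    exact (h.pos s ⟨ha.trans hs.1.le, hs.2.trans_le hb⟩).le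

/-- A radial weight with `(1 - r) ω(r) ≤ β ω̂(r)`, normalised by `∫_0^1 ω = 1`. -/
structure IsDoublingWeight (ω : ℝ → ℝ) (β : ℝ) : Prop extends IsContinuousRadialWeight ω where
  pos_exponent : 0 < β
  mul_le : ∀ r ∈ Ico (0 : ℝ) 1, (1 - r) * ω r ≤ β * tailIntegral ω r
  integral_eq_one : ∫ r in (0 : ℝ)..1, ω r = 1

lemma IsRegularWeight.exists_isDoublingWeight {ω : ℝ → ℝ} (h : IsRegularWeight ω)
    (h1 : ∫ r in (0 : ℝ)..1, ω r = 1) : ∃ β, IsDoublingWeight ω β := by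
  obtain ⟨hc, C, hC, hd⟩ := h
  refine ⟨C, hc, hC, fun r hr => ?_, h1⟩
  have := (hd r hr).2
  have hp := hc.pos r hr
  rw [distortion] at this
  calc (1 - r) * ω r ≤ C * (1 / ω r * tailIntegral ω r) * ω r := by gcongr
    _ = C * tailIntegral ω r := by field_simp

/-- Near 1 the quotient ψ_ω(r)/(1 - r) exceeds 1, so the constant 1 serves there; on the remaining
compact interval continuity bounds (1 - r) ω / ω̂. -/
lemma IsRapidlyIncreasingWeight.exists_isDoublingWeight {ω : ℝ → ℝ}
    (h : IsRapidlyIncreasingWeight ω) (h1 : ∫ r in (0 : ℝ)..1, ω r = 1) :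
    ∃ β, IsDoublingWeight ω β := by
  obtain ⟨hc, ht⟩ := h
  have hev := ht.eventually_ge_atTop 1
  obtain ⟨δ, hδ, hδ'⟩ : ∃ δ ∈ Iio (1 : ℝ), Ioo δ 1 ⊆ {r | 1 ≤ distortion ω r / (1 - r)} :=
    (mem_nhdsLT_iff_exists_Ioo_subset).1 hev
  have hcont : ContinuousOn (fun r => (1 - r) * ω r / tailIntegral ω r) (Icc 0 δ) := by
    have hs : Icc (0 : ℝ) δ ⊆ Ico 0 1 := fun x hx => ⟨hx.1, hx.2.trans_lt hδ⟩
    refine ContinuousOn.div ?_ (hc.continuousOn_tailIntegral.mono (hs.trans Ico_subset_Icc_self))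
      fun x hx => (hc.tailIntegral_pos (hs hx)).ne'
    exact (continuousOn_const.sub continuousOn_id).mul (hc.continuousOn.mono hs)
  obtain ⟨B, hB⟩ := isCompact_Icc.bddAbove_image hcont
  refine ⟨max B 1, hc, by positivity, fun r hr => ?_, h1⟩
  have hT := hc.tailIntegral_pos hr
  have hp := hc.pos r hr
  rcases le_or_gt r δ with hrδ | hrδ
  · have := hB (mem_image_of_mem _ (⟨hr.1, hrδ⟩ : r ∈ Icc 0 δ))
    rw [div_le_iff₀ hT] at this
    exact this.trans (by gcongr; exact le_max_left _ _)
  · have : 1 ≤ distortion ω r / (1 - r) := hδ' ⟨hrδ, hr.2⟩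
    rw [le_div_iff₀ (by linarith [hr.2]), one_mul, distortion] at this
    calc (1 - r) * ω r ≤ (1 / ω r * tailIntegral ω r) * ω r := by gcongr
      _ = 1 * tailIntegral ω r := by field_simp
      _ ≤ _ := by gcongr; exact le_max_right _ _

/-! ### Doubling of ω̂ and decay of powers -/

namespace IsDoublingWeight

variable {ω : ℝ → ℝ} {β : ℝ}

lemma tailIntegral_zero (h : IsDoublingWeight ω β) : tailIntegral ω 0 = 1 := h.integral_eq_one

lemma tailIntegral_le_one (h : IsDoublingWeight ω β) {r : ℝ} (hr : r ∈ Icc (0 : ℝ) 1) :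
    tailIntegral ω r ≤ 1 := by
  rw [← h.tailIntegral_zero]
  exact h.strictAntiOn_tailIntegral.antitoneOn (left_mem_Icc.2 zero_le_one) hr hr.1

/-- The doubling estimate `ω̂(r) ≤ ((1 - r) / (1 - s))^β ω̂(s)` for `r ≤ s`. -/
lemma tailIntegral_le (h : IsDoublingWeight ω β) {r s : ℝ} (hr : 0 ≤ r) (hrs : r ≤ s)
    (hs : s < 1) : tailIntegral ω r ≤ ((1 - r) / (1 - s)) ^ β * tailIntegral ω s := by
  -- The derivative is (1 - x)^(-β-1) (β ω̂(x) - (1 - x) ω(x)), nonnegative by `mul_le`.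
  have hmono : MonotoneOn (fun x => tailIntegral ω x * (1 - x) ^ (-β)) (Ico 0 1) := by
    have hd : ∀ x ∈ Ioo (0 : ℝ) 1, HasDerivAt (fun x => tailIntegral ω x * (1 - x) ^ (-β))
        (-ω x * (1 - x) ^ (-β) + tailIntegral ω x * (-1 * (-β) * (1 - x) ^ (-β - 1))) x := by
      intro x hx
      refine (h.hasDerivAt_tailIntegral hx).mul ?_
      exact ((hasDerivAt_id x).const_sub 1).rpow_const (Or.inl (by simp; linarith [hx.2]))
    refine monotoneOn_of_deriv_nonneg (convex_Ico 0 1) ?_ ?_ ?_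
    · refine (h.continuousOn_tailIntegral.mono Ico_subset_Icc_self).mul ?_
      refine ContinuousOn.rpow_const (by fun_prop) fun x hx => Or.inl ?_
      linarith [hx.2]
    · rw [interior_Ico]
      exact fun x hx => (hd x hx).differentiableAt.differentiableWithinAt
    · rw [interior_Ico]
      intro x hx
      rw [(hd x hx).deriv]
      have hx1 : 0 < 1 - x := by linarith [hx.2]
      have e : (1 - x) ^ (-β) = (1 - x) * (1 - x) ^ (-β - 1) := by
        rw [Real.rpow_sub_one hx1.ne']; field_simp
      rw [e]
      have := h.mul_le x ⟨hx.1.le, hx.2⟩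
      have hp : 0 < (1 - x) ^ (-β - 1) := by positivity
      nlinarith
  have h1 := hmono ⟨hr, hrs.trans_lt hs⟩ ⟨hr.trans hrs, hs⟩ hrs
  have hr1 : 0 < 1 - r := by linarith
  have hs1 : 0 < 1 - s := by linarith
  simp only [Real.rpow_neg hr1.le, Real.rpow_neg hs1.le] at h1
  rw [Real.div_rpow hr1.le hs1.le]
  rw [← div_eq_mul_inv, ← div_eq_mul_inv, div_le_iff₀ (by positivity)] at h1
  calc _ ≤ _ := h1
    _ = _ := by ring

lemma one_sub_one_div_mem {n : ℕ} (hn : 1 ≤ n) : 1 - 1 / (n : ℝ) ∈ Ico (0 : ℝ) 1 := by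
  have : (1 : ℝ) ≤ n := by exact_mod_cast hn
  refine ⟨?_, ?_⟩
  · rw [sub_nonneg, div_le_one (by linarith)]; exact this
  · have : 0 < 1 / (n : ℝ) := by positivity
    linarith

/-- Powers decay faster than any power of the ratio of tail integrals. -/
lemma exists_pow_le (h : IsDoublingWeight ω β) {γ : ℝ} (hγ : 0 < γ) : ∃ C : ℝ, 1 ≤ C ∧
    ∀ n : ℕ, 1 ≤ n → ∀ r : ℝ, 0 ≤ r → r ≤ 1 - 1 / (n : ℝ) →
      r ^ n ≤ C * (tailIntegral ω (1 - 1 / (n : ℝ)) / tailIntegral ω r) ^ γ := by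
  -- With x = n(1 - r) ≥ 1, doubling bounds the inverse ratio by x^β, while r^n ≤ e^{-x}. It remains
  -- to absorb x^{βγ} ≤ x^N ≤ N! e^x, whence the constant N!.
  set N := ⌈β * γ⌉₊ with hN
  refine ⟨N.factorial, by exact_mod_cast Nat.one_le_iff_ne_zero.2 N.factorial_ne_zero,
    fun n hn r hr hrn => ?_⟩
  have hs := one_sub_one_div_mem hn
  have hn0 : (0 : ℝ) < n := by exact_mod_cast hn
  have hTs := h.tailIntegral_pos hs
  have hTr := h.tailIntegral_pos ⟨hr, hrn.trans_lt hs.2⟩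
  set x := (n : ℝ) * (1 - r) with hx
  have hx1 : 1 ≤ x := by
    rw [hx]
    have : 1 / (n : ℝ) ≤ 1 - r := by linarith
    rw [div_le_iff₀ hn0] at this
    linarith
  have hx0 : 0 < x := by linarith
  have hd := h.tailIntegral_le hr hrn hs.2
  have e : (1 - r) / (1 - (1 - 1 / (n : ℝ))) = x := by rw [hx]; field_simp; ring
  rw [e] at hd
  have hq : tailIntegral ω r / tailIntegral ω (1 - 1 / (n : ℝ)) ≤ x ^ β := by
    rwa [div_le_iff₀ hTs]
  have hrexp : r ^ n ≤ Real.exp (-x) := by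
    have h1 : r ≤ Real.exp (-(1 - r)) := by
      have := Real.add_one_le_exp (-(1 - r)); linarith
    calc r ^ n ≤ (Real.exp (-(1 - r))) ^ n := by gcongr
      _ = Real.exp (-x) := by rw [← Real.exp_nat_mul, hx]; ring_nf
  have hexp : x ^ (β * γ) ≤ N.factorial * Real.exp x := by
    have h2 := Real.pow_div_factorial_le_exp x hx0.le N
    rw [div_le_iff₀ (by positivity)] at h2
    calc x ^ (β * γ) ≤ x ^ (N : ℝ) := Real.rpow_le_rpow_of_exponent_le hx1 (Nat.le_ceil _)
      _ = x ^ N := Real.rpow_natCast _ _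
      _ ≤ _ := by linarith
  have hu : (tailIntegral ω (1 - 1 / (n : ℝ)) / tailIntegral ω r) ^ γ
      = ((tailIntegral ω r / tailIntegral ω (1 - 1 / (n : ℝ))) ^ γ)⁻¹ := by
    rw [← Real.inv_rpow (by positivity), inv_div]
  have hle : (tailIntegral ω r / tailIntegral ω (1 - 1 / (n : ℝ))) ^ γ
      ≤ N.factorial * Real.exp x := by
    refine le_trans ?_ hexp
    rw [Real.rpow_mul hx0.le]
    gcongr
  rw [hu, ← div_eq_mul_inv, le_div_iff₀ (by positivity)]
  calc _ ≤ Real.exp (-x) * (N.factorial * Real.exp x) := by gcongr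
    _ = N.factorial * (Real.exp (-x) * Real.exp x) := by ring
    _ = N.factorial := by rw [← Real.exp_add]; simp

end IsDoublingWeight

/-! ### The kernel and its integral against ω -/

/-- A nonnegative derivative of a function continuous up to the endpoints is automatically
integrable. This matters at r = 1, where the integrands below may blow up. -/
lemma lintegral_Ioo_deriv_of_nonneg {G g : ℝ → ℝ} {a b : ℝ} (hab : a ≤ b)
    (hG : ContinuousOn G (Icc a b)) (hd : ∀ x ∈ Ioo a b, HasDerivAt G (g x) x)
    (hg : ∀ x ∈ Ioo a b, 0 ≤ g x) :
    ∫⁻ x in Ioo a b, ENNReal.ofReal (g x) = ENNReal.ofReal (G b - G a) := by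
  have hI : IntegrableOn g (Ioc a b) := intervalIntegral.integrableOn_deriv_of_nonneg hG hd hg
  have hI' : IntervalIntegrable g volume a b := (intervalIntegrable_iff_integrableOn_Ioc_of_le hab).2 hI
  rw [← intervalIntegral.integral_eq_sub_of_hasDerivAt_of_le hab hG hd hI',
    intervalIntegral.integral_of_le hab, integral_Ioc_eq_integral_Ioo,
    ofReal_integral_eq_lintegral_ofReal (hI.mono_set Ioo_subset_Ioc_self)]
  filter_upwards [ae_restrict_mem measurableSet_Ioo] with x hx using hg x hx

/-- A kernel, concentrated near `r = s`, with `∫ decayKernel ω s · ω ≲ ω̂(s)`. -/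
def decayKernel (ω : ℝ → ℝ) (s r : ℝ) : ℝ :=
  if r < s then (tailIntegral ω s / tailIntegral ω r) ^ (2 : ℝ)
  else (tailIntegral ω s / tailIntegral ω r) ^ (1 / 2 : ℝ)

namespace IsDoublingWeight

variable {ω : ℝ → ℝ} {β : ℝ}

lemma decayKernel_nonneg (h : IsDoublingWeight ω β) {s r : ℝ} (hs : s ∈ Icc (0 : ℝ) 1)
    (hr : r ∈ Icc (0 : ℝ) 1) : 0 ≤ decayKernel ω s r := by
  have := div_nonneg (h.tailIntegral_nonneg hs) (h.tailIntegral_nonneg hr)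
  unfold decayKernel
  split_ifs <;> positivity

/-- Since ω/ω̂² is the derivative of 1/ω̂, the integral is ω̂(s)²(1/ω̂(s) - 1). Any exponent above 1
in the kernel would do on this side. -/
lemma lintegral_decayKernel_left (h : IsDoublingWeight ω β) {s : ℝ} (hs : s ∈ Ico (0 : ℝ) 1) :
    ∫⁻ r in Ioo 0 s, ENNReal.ofReal (decayKernel ω s r * ω r) ≤
      ENNReal.ofReal (tailIntegral ω s) := by
  have hTs := h.tailIntegral_pos hs
  have e : ∀ r ∈ Ioo 0 s, ENNReal.ofReal (decayKernel ω s r * ω r) =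
      ENNReal.ofReal (tailIntegral ω s ^ 2 * (ω r / tailIntegral ω r ^ 2)) := by
    intro r hr
    rw [decayKernel, if_pos hr.2, Real.rpow_two]
    congr 1
    ring
  rw [setLIntegral_congr_fun measurableSet_Ioo e,
    lintegral_Ioo_deriv_of_nonneg (G := fun r => tailIntegral ω s ^ 2 * (tailIntegral ω r)⁻¹) hs.1]
  · refine ENNReal.ofReal_le_ofReal ?_
    rw [h.tailIntegral_zero]
    have : tailIntegral ω s ^ 2 * (tailIntegral ω s)⁻¹ = tailIntegral ω s := by field_simp
    rw [this]
    nlinarith [sq_nonneg (tailIntegral ω s)]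
  · refine continuousOn_const.mul (ContinuousOn.inv₀ (h.continuousOn_tailIntegral.mono ?_) ?_)
    · exact fun x hx => ⟨hx.1, hx.2.trans hs.2.le⟩
    · exact fun x hx => (h.tailIntegral_pos ⟨hx.1, hx.2.trans_lt hs.2⟩).ne'
  · intro x hx
    have := ((h.hasDerivAt_tailIntegral ⟨hx.1, hx.2.trans hs.2⟩).inv
      (h.tailIntegral_pos ⟨hx.1.le, hx.2.trans hs.2⟩).ne').const_mul (tailIntegral ω s ^ 2)
    simpa using this
  · intro x hx
    have := h.pos x ⟨hx.1.le, hx.2.trans hs.2⟩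
    positivity

/-- A primitive is -2 (ω̂(s) ω̂(r))^{1/2}, which vanishes at r = 1. An exponent in (0, 1) is what
makes the kernel integrable up to 1. -/
lemma lintegral_decayKernel_right (h : IsDoublingWeight ω β) {s : ℝ} (hs : s ∈ Ico (0 : ℝ) 1) :
    ∫⁻ r in Ioo s 1, ENNReal.ofReal (decayKernel ω s r * ω r) =
      ENNReal.ofReal (2 * tailIntegral ω s) := by
  have hTs := h.tailIntegral_pos hs
  have e : ∀ r ∈ Ioo s 1, ENNReal.ofReal (decayKernel ω s r * ω r) =
      ENNReal.ofReal (-(2 * tailIntegral ω s ^ (1 / 2 : ℝ)) *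
        (-ω r * (1 / 2) * tailIntegral ω r ^ ((1 / 2 : ℝ) - 1))) := by
    intro r hr
    have hT := h.tailIntegral_pos ⟨hs.1.trans hr.1.le, hr.2⟩
    rw [decayKernel, if_neg hr.1.not_gt, Real.div_rpow hTs.le hT.le,
      show (1 / 2 : ℝ) - 1 = -(1 / 2) by norm_num, Real.rpow_neg hT.le]
    congr 1
    ring
  rw [setLIntegral_congr_fun measurableSet_Ioo e,
    lintegral_Ioo_deriv_of_nonneg
      (G := fun r => -(2 * tailIntegral ω s ^ (1 / 2 : ℝ)) * tailIntegral ω r ^ (1 / 2 : ℝ)) hs.2.le]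
  · congr 1
    rw [tailIntegral_one, Real.zero_rpow (by norm_num)]
    have : tailIntegral ω s ^ (1 / 2 : ℝ) * tailIntegral ω s ^ (1 / 2 : ℝ) = tailIntegral ω s := by
      rw [← Real.rpow_add hTs]; norm_num
    linear_combination 2 * this
  · refine continuousOn_const.mul (ContinuousOn.rpow_const (h.continuousOn_tailIntegral.mono ?_) ?_)
    · exact fun x hx => ⟨hs.1.trans hx.1, hx.2⟩
    · exact fun x hx => Or.inr (by norm_num)
  · intro x hx
    exact ((h.hasDerivAt_tailIntegral ⟨hs.1.trans_lt hx.1, hx.2⟩).rpow_const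
      (Or.inl (h.tailIntegral_pos ⟨hs.1.trans hx.1.le, hx.2⟩).ne')).const_mul _
  · intro x hx
    have := h.pos x ⟨hs.1.trans hx.1.le, hx.2⟩
    have hT := h.tailIntegral_pos ⟨hs.1.trans hx.1.le, hx.2⟩
    have : 0 ≤ 2 * tailIntegral ω s ^ (1 / 2 : ℝ) *
        (ω x * (1 / 2) * tailIntegral ω x ^ ((1 / 2 : ℝ) - 1)) := by positivity
    linarith

lemma lintegral_decayKernel_le (h : IsDoublingWeight ω β) {s : ℝ} (hs : s ∈ Ico (0 : ℝ) 1) :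
    ∫⁻ r in Ioo 0 1, ENNReal.ofReal (decayKernel ω s r * ω r) ≤
      ENNReal.ofReal (3 * tailIntegral ω s) := by
  have hTs := h.tailIntegral_pos hs
  have hae : (Ioo (0 : ℝ) 1 : Set ℝ) ⊆ (Ioo 0 s ∪ Ioo s 1) ∪ {s} := by
    intro x hx
    rcases lt_trichotomy x s with hxs | hxs | hxs
    · exact Or.inl (Or.inl ⟨hx.1, hxs⟩)
    · exact Or.inr hxs
    · exact Or.inl (Or.inr ⟨hxs, hx.2⟩)
  calc _ ≤ _ := lintegral_mono_set hae
    _ ≤ _ := lintegral_union_le _ _ _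
    _ ≤ _ := add_le_add_left (lintegral_union_le _ _ _) _
    _ ≤ ENNReal.ofReal (tailIntegral ω s) + ENNReal.ofReal (2 * tailIntegral ω s) + 0 := by
        rw [h.lintegral_decayKernel_right hs]
        gcongr
        · exact h.lintegral_decayKernel_left hs
        · simp
    _ = _ := by
        rw [add_zero, ← ENNReal.ofReal_add hTs.le (by positivity)]
        congr 1
        ring

lemma aemeasurable_decayKernel (h : IsDoublingWeight ω β) (s : ℝ) :
    AEMeasurable (fun r => decayKernel ω s r * ω r) (volume.restrict (Ioo 0 1)) := by
  have hT : AEMeasurable (tailIntegral ω) (volume.restrict (Ioo 0 1)) :=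
    (h.continuousOn_tailIntegral.mono Ioo_subset_Icc_self).aemeasurable measurableSet_Ioo
  have hw : AEMeasurable ω (volume.restrict (Ioo 0 1)) :=
    (h.continuousOn.mono Ioo_subset_Ico_self).aemeasurable measurableSet_Ioo
  refine AEMeasurable.mul ?_ hw
  have e : decayKernel ω s =
      (Iio s).indicator (fun r => (tailIntegral ω s / tailIntegral ω r) ^ (2 : ℝ)) +
      (Iio s)ᶜ.indicator (fun r => (tailIntegral ω s / tailIntegral ω r) ^ (1 / 2 : ℝ)) := by
    ext r; by_cases hr : r < s
    · simp [decayKernel, hr]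
    · simp [decayKernel, hr, not_lt.1 hr]
  rw [e]
  exact (((hT.const_div _).pow_const _).indicator measurableSet_Iio).add
    (((hT.const_div _).pow_const _).indicator measurableSet_Iio.compl)

/-- Powers are dominated by the kernel, with room for a factor decaying away from `r = s`. -/
lemma exists_pow_le_decayKernel (h : IsDoublingWeight ω β) {q : ℝ} (hq : 0 < q) : ∃ C : ℝ, 1 ≤ C ∧
    ∀ n : ℕ, 1 ≤ n → ∀ r ∈ Ico (0 : ℝ) 1,
      r ^ n ≤ C * (decayKernel ω (1 - 1 / (n : ℝ)) r ^ (1 / q) *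
        min (tailIntegral ω (1 - 1 / (n : ℝ)) / tailIntegral ω r)
          (tailIntegral ω r / tailIntegral ω (1 - 1 / (n : ℝ))) ^ (1 / (2 * q))) := by
  -- For r < s the kernel contributes the exponent 2/q of ω̂(s)/ω̂(r) and the minimum contributes
  -- 1/(2q); γ is their sum.
  obtain ⟨C, hC, hle⟩ := h.exists_pow_le (γ := 2 * (1 / q) + 1 / (2 * q)) (by positivity)
  refine ⟨C, hC, fun n hn r hr => ?_⟩
  have hs := one_sub_one_div_mem hn
  have hTs := h.tailIntegral_pos hs
  have hTr := h.tailIntegral_pos hr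
  have hle := hle n hn r hr.1
  set s := 1 - 1 / (n : ℝ)
  have hu : 0 < tailIntegral ω s / tailIntegral ω r := by positivity
  rcases lt_or_ge r s with hrs | hrs
  · have hT : tailIntegral ω s ≤ tailIntegral ω r := h.strictAntiOn_tailIntegral.antitoneOn
      (Ico_subset_Icc_self hr) (Ico_subset_Icc_self hs) hrs.le
    rw [decayKernel, if_pos hrs, min_eq_left, ← Real.rpow_mul hu.le, ← Real.rpow_add hu]
    · exact hle hrs.le
    · exact ((div_le_one hTr).2 hT).trans ((one_le_div hTs).2 hT)
  · have hT : tailIntegral ω r ≤ tailIntegral ω s := h.strictAntiOn_tailIntegral.antitoneOn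
      (Ico_subset_Icc_self hs) (Ico_subset_Icc_self hr) hrs
    have e : (tailIntegral ω r / tailIntegral ω s) = (tailIntegral ω s / tailIntegral ω r)⁻¹ :=
      (inv_div _ _).symm
    -- For r ≥ s the two factors are inverse to each other, so the claim is only r^n ≤ C.
    rw [decayKernel, if_neg hrs.not_gt, min_eq_right, ← Real.rpow_mul hu.le, e,
      Real.inv_rpow hu.le, show 1 / 2 * (1 / q) = 1 / (2 * q) by field_simp,
      mul_inv_cancel₀ (by positivity), mul_one]
    · exact (pow_le_one₀ hr.1 hr.2.le).trans hC
    · exact ((div_le_one hTs).2 hT).trans ((one_le_div hTr).2 hT)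

end IsDoublingWeight

/-! ### Upper estimate of the mixed norm -/

lemma pow_mul_le_of_mul_le {T : ℕ → ℝ} {lam : ℝ} (hlam : 0 < lam)
    (hT : ∀ k, lam * T (k + 1) ≤ T k) (k j : ℕ) : lam ^ j * T (k + j) ≤ T k := by
  induction j with
  | zero => simp
  | succ j ih =>
    calc lam ^ (j + 1) * T (k + (j + 1)) = lam ^ j * (lam * T (k + j + 1)) := by
          rw [pow_succ]; ring_nf
      _ ≤ lam ^ j * T (k + j) := by gcongr; exact hT _
      _ ≤ T k := ih

/-- A geometrically decreasing sequence, measured multiplicatively from a fixed point. -/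
lemma tsum_min_div_rpow_le {T : ℕ → ℝ} {lam δ t : ℝ} (hlam : 1 < lam) (hδ : 0 < δ) (ht : 0 < t)
    (hpos : ∀ k, 0 < T k) (hT : ∀ k, lam * T (k + 1) ≤ T k) :
    ∑' k, ENNReal.ofReal (min (T k / t) (t / T k) ^ δ) ≤
      2 * (1 - ENNReal.ofReal (lam ^ (-δ)))⁻¹ := by
  have hl0 : 0 < lam := by linarith
  have hex : ∃ k, T k < t := by
    obtain ⟨j, hj⟩ := pow_unbounded_of_one_lt (T 0 / t) hlam
    refine ⟨j, ?_⟩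
    have h1 := pow_mul_le_of_mul_le hl0 hT 0 j
    rw [div_lt_iff₀ ht] at hj
    rw [zero_add] at h1
    exact lt_of_mul_lt_mul_left (h1.trans_lt hj) (by positivity)
  classical
  -- The first index where the sequence drops below t. Moving away from it in either direction, the
  -- minimum decays by powers of 1/lam, giving one geometric series per side.
  set k0 := Nat.find hex with hk0
  have hpow : ∀ {x : ℝ} (j : ℕ), 0 ≤ x → x ≤ (lam ^ j)⁻¹ →
      ENNReal.ofReal (x ^ δ) ≤ ENNReal.ofReal (lam ^ (-δ)) ^ j := by
    intro x j hx0 hx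
    rw [← ENNReal.ofReal_pow (by positivity)]
    refine ENNReal.ofReal_le_ofReal ?_
    calc x ^ δ ≤ ((lam ^ j)⁻¹) ^ δ := by gcongr
      _ = (lam ^ (-δ)) ^ j := by
        rw [Real.inv_rpow (by positivity), ← Real.rpow_natCast, ← Real.rpow_mul hl0.le,
          ← Real.rpow_neg hl0.le, ← Real.rpow_natCast, ← Real.rpow_mul hl0.le]
        ring_nf
  have hmin : ∀ k, 0 ≤ min (T k / t) (t / T k) := fun k =>
    le_min (div_nonneg (hpos k).le ht.le) (div_nonneg ht.le (hpos k).le)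
  rw [← Summable.sum_add_tsum_nat_add' (k := k0) ENNReal.summable, two_mul]
  refine add_le_add ?_ ?_
  · rw [← Finset.sum_range_reflect]
    calc _ ≤ ∑ j ∈ Finset.range k0, ENNReal.ofReal (lam ^ (-δ)) ^ j := by
          refine Finset.sum_le_sum fun j hj => hpow j (hmin _) ?_
          rw [Finset.mem_range] at hj
          refine (min_le_right _ _).trans ?_
          have h1 := pow_mul_le_of_mul_le hl0 hT (k0 - 1 - j) j
          have h2 : t ≤ T (k0 - 1) := not_lt.1 (Nat.find_min hex (by omega : k0 - 1 < k0))
          rw [show k0 - 1 - j + j = k0 - 1 by omega] at h1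
          rw [div_le_iff₀ (hpos _), inv_mul_eq_div, le_div_iff₀ (by positivity)]
          calc t * lam ^ j ≤ T (k0 - 1) * lam ^ j := by gcongr
            _ = lam ^ j * T (k0 - 1) := mul_comm _ _
            _ ≤ _ := h1
      _ ≤ ∑' j, ENNReal.ofReal (lam ^ (-δ)) ^ j := ENNReal.sum_le_tsum _
      _ = _ := ENNReal.tsum_geometric _
  · rw [← ENNReal.tsum_geometric]
    refine ENNReal.tsum_le_tsum fun j => hpow j (hmin _) ?_
    refine (min_le_left _ _).trans ?_
    have h1 := pow_mul_le_of_mul_le hl0 hT k0 j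
    have h2 : T k0 < t := Nat.find_spec hex
    rw [div_le_iff₀ ht, inv_mul_eq_div, le_div_iff₀ (by positivity), add_comm j]
    linarith

/-- The sum `∑_k |a_k|^q ω̂(1 - 1/n_k)`. -/
def tailSum (ω : ℝ → ℝ) (a : ℕ → ℂ) (n : ℕ → ℕ) (q : ℝ) : ℝ≥0∞ :=
  ∑' k : ℕ, ‖a k‖ₑ ^ q * ENNReal.ofReal (tailIntegral ω (1 - 1 / (n k : ℝ)))

lemma lintegral_circle_const (B : ℝ≥0∞) :
    ENNReal.ofReal (1 / (2 * Real.pi)) * ∫⁻ _ in Icc (0 : ℝ) (2 * Real.pi), B = B := by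
  have hpi : 0 < 2 * Real.pi := by positivity
  rw [lintegral_const, Measure.restrict_apply MeasurableSet.univ, univ_inter, Real.volume_Icc,
    sub_zero, mul_left_comm, ← ENNReal.ofReal_mul (by positivity), one_div,
    inv_mul_cancel₀ hpi.ne', ENNReal.ofReal_one, mul_one]

lemma integralMean_le {p : ℝ≥0∞} (hp : 0 < p) {r : ℝ} {f : ℂ → ℂ} {B : ℝ≥0∞}
    (hB : ∀ θ, ‖f (circleMap 0 r θ)‖ₑ ≤ B) : integralMean p r f ≤ B := by
  unfold integralMean
  split_ifs with h
  · exact iSup₂_le fun θ _ => hB θ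
  · have hp' : 0 < p.toReal := ENNReal.toReal_pos hp.ne' h
    calc _ ≤ (B ^ p.toReal) ^ (1 / p.toReal) := by
          rw [← lintegral_circle_const (B ^ p.toReal)]
          gcongr
          exact hB _
      _ = B := by rw [← ENNReal.rpow_mul, mul_one_div_cancel hp'.ne', ENNReal.rpow_one]

namespace IsLacunarySeries

variable {ω : ℝ → ℝ} {β lam : ℝ} {f : ℂ → ℂ} {a : ℕ → ℂ} {n : ℕ → ℕ}

lemma mul_tailIntegral_le (hf : IsLacunarySeries ω lam f a n) (h : IsDoublingWeight ω β) (k : ℕ) :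
    lam * tailIntegral ω (1 - 1 / (n (k + 1) : ℝ)) ≤ tailIntegral ω (1 - 1 / (n k : ℝ)) :=
  (le_div_iff₀ (h.tailIntegral_pos (IsDoublingWeight.one_sub_one_div_mem (hf.one_le _)))).1
    (hf.ratio k)

lemma enorm_apply_le (hf : IsLacunarySeries ω lam f a n) {r : ℝ} (hr : r ∈ Ico (0 : ℝ) 1) (θ : ℝ) :
    ‖f (circleMap 0 r θ)‖ₑ ≤ ∑' k, ‖a k‖ₑ * ENNReal.ofReal (r ^ n k) := by
  have hz : circleMap 0 r θ ∈ Metric.ball (0 : ℂ) 1 := by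
    simp [abs_of_nonneg hr.1, hr.2]
  rw [← (hf.hasSum _ hz).tsum_eq]
  refine (enorm_tsum_le_tsum_enorm).trans_eq ?_
  congr 1
  ext k
  rw [enorm_mul, enorm_pow, ENNReal.ofReal_pow hr.1]
  congr 2
  rw [← ofReal_norm]
  simp [abs_of_nonneg hr.1]

end IsLacunarySeries

namespace IsDoublingWeight

variable {ω : ℝ → ℝ} {β : ℝ}

/-- Each |a_k| times the 1/q-th power of its kernel is at most the 1/q-th power of the whole sum,
and the leftover minima are summable over k uniformly in r. No Hölder inequality is used, so q < 1
and q ≥ 1 are treated alike. -/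
lemma exists_tsum_rpow_le (h : IsDoublingWeight ω β) {q lam : ℝ} (hq : 0 < q) (hlam : 1 < lam) :
    ∃ C : ℝ≥0∞, C ≠ ∞ ∧ ∀ (f : ℂ → ℂ) (a : ℕ → ℂ) (n : ℕ → ℕ), IsLacunarySeries ω lam f a n →
      ∀ r ∈ Ico (0 : ℝ) 1, (∑' k, ‖a k‖ₑ * ENNReal.ofReal (r ^ n k)) ^ q ≤
        C * ∑' k, ‖a k‖ₑ ^ q * ENNReal.ofReal (decayKernel ω (1 - 1 / (n k : ℝ)) r) := by
  obtain ⟨C, hC, hpow⟩ := h.exists_pow_le_decayKernel hq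
  set K := 2 * (1 - ENNReal.ofReal (lam ^ (-(1 / (2 * q)))))⁻¹ with hK
  have hKtop : K ≠ ∞ := by
    refine ENNReal.mul_ne_top (by simp) (ENNReal.inv_ne_top.2 ?_)
    rw [ne_eq, tsub_eq_zero_iff_le, not_le, ENNReal.ofReal_lt_one]
    exact Real.rpow_lt_one_of_one_lt_of_neg hlam (by simp [hq])
  refine ⟨(ENNReal.ofReal C * K) ^ q, ENNReal.rpow_ne_top_of_nonneg hq.le
    (ENNReal.mul_ne_top ENNReal.ofReal_ne_top hKtop), fun f a n hf r hr => ?_⟩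
  set S := ∑' k, ‖a k‖ₑ ^ q * ENNReal.ofReal (decayKernel ω (1 - 1 / (n k : ℝ)) r) with hS
  have hs := fun k => one_sub_one_div_mem (hf.one_le k)
  have hTr := h.tailIntegral_pos hr
  have hterm : ∀ k, ‖a k‖ₑ * ENNReal.ofReal (r ^ n k) ≤ ENNReal.ofReal C * S ^ (1 / q) *
      ENNReal.ofReal (min (tailIntegral ω (1 - 1 / (n k : ℝ)) / tailIntegral ω r)
        (tailIntegral ω r / tailIntegral ω (1 - 1 / (n k : ℝ))) ^ (1 / (2 * q))) := by
    intro k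
    have hD := h.decayKernel_nonneg (Ico_subset_Icc_self (hs k)) (Ico_subset_Icc_self hr)
    have h1 : ‖a k‖ₑ * ENNReal.ofReal (decayKernel ω (1 - 1 / (n k : ℝ)) r ^ (1 / q)) ≤
        S ^ (1 / q) := by
      rw [← ENNReal.ofReal_rpow_of_nonneg hD (by positivity)]
      calc _ = (‖a k‖ₑ ^ q * ENNReal.ofReal (decayKernel ω (1 - 1 / (n k : ℝ)) r)) ^ (1 / q) := by
            rw [ENNReal.mul_rpow_of_nonneg _ _ (by positivity), ← ENNReal.rpow_mul,
              mul_one_div_cancel hq.ne', ENNReal.rpow_one]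
        _ ≤ S ^ (1 / q) := by gcongr; exact ENNReal.le_tsum k
    set H := min (tailIntegral ω (1 - 1 / (n k : ℝ)) / tailIntegral ω r)
        (tailIntegral ω r / tailIntegral ω (1 - 1 / (n k : ℝ))) ^ (1 / (2 * q))
    calc _ ≤ ‖a k‖ₑ * ENNReal.ofReal (C * (decayKernel ω (1 - 1 / (n k : ℝ)) r ^ (1 / q) * H)) := by
          gcongr; exact hpow (n k) (hf.one_le k) r hr
      _ = ENNReal.ofReal C * (‖a k‖ₑ * ENNReal.ofReal
          (decayKernel ω (1 - 1 / (n k : ℝ)) r ^ (1 / q))) * ENNReal.ofReal H := by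
          rw [ENNReal.ofReal_mul (by positivity), ENNReal.ofReal_mul (by positivity)]
          ring
      _ ≤ _ := by gcongr
  calc _ ≤ (ENNReal.ofReal C * S ^ (1 / q) * K) ^ q := by
        gcongr
        refine (ENNReal.tsum_le_tsum hterm).trans ?_
        rw [ENNReal.tsum_mul_left]
        gcongr
        exact tsum_min_div_rpow_le hlam (by positivity) hTr (fun k => h.tailIntegral_pos (hs k))
          (hf.mul_tailIntegral_le h)
    _ = (ENNReal.ofReal C * K * S ^ (1 / q)) ^ q := by ring_nf
    _ = _ := by
        rw [ENNReal.mul_rpow_of_nonneg _ _ hq.le, ← ENNReal.rpow_mul, one_div_mul_cancel hq.ne',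
          ENNReal.rpow_one]

theorem exists_mixedNormPow_le_tailSum (h : IsDoublingWeight ω β) {p : ℝ≥0∞} (hp : 0 < p)
    {q lam : ℝ} (hq : 0 < q) (hlam : 1 < lam) :
    ∃ C : ℝ≥0∞, C ≠ ∞ ∧ ∀ (f : ℂ → ℂ) (a : ℕ → ℂ) (n : ℕ → ℕ), IsLacunarySeries ω lam f a n →
      mixedNormPow p q ω f ≤ C * tailSum ω a n q := by
  obtain ⟨C, hC, hle⟩ := h.exists_tsum_rpow_le hq hlam
  refine ⟨C * 3, ENNReal.mul_ne_top hC (by simp), fun f a n hf => ?_⟩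
  have hs := fun k => one_sub_one_div_mem (hf.one_le k)
  calc mixedNormPow p q ω f ≤ ∫⁻ r in Ioo (0 : ℝ) 1, C * ∑' k, ‖a k‖ₑ ^ q *
        ENNReal.ofReal (decayKernel ω (1 - 1 / (n k : ℝ)) r * ω r) := by
        refine setLIntegral_mono' measurableSet_Ioo fun r hr => ?_
        have hr' : r ∈ Ico (0 : ℝ) 1 := ⟨hr.1.le, hr.2⟩
        calc _ ≤ (C * ∑' k, ‖a k‖ₑ ^ q * ENNReal.ofReal (decayKernel ω (1 - 1 / (n k : ℝ)) r)) *
              ENNReal.ofReal (ω r) := by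
              gcongr
              refine le_trans ?_ (hle f a n hf r hr')
              gcongr
              exact integralMean_le hp (hf.enorm_apply_le hr')
          _ = _ := by
              rw [mul_assoc, ← ENNReal.tsum_mul_right]
              congr 2
              ext k
              rw [mul_assoc, ENNReal.ofReal_mul (h.decayKernel_nonneg
                (Ico_subset_Icc_self (hs k)) (Ico_subset_Icc_self hr'))]
    _ = C * ∑' k, ‖a k‖ₑ ^ q * ∫⁻ r in Ioo (0 : ℝ) 1,
          ENNReal.ofReal (decayKernel ω (1 - 1 / (n k : ℝ)) r * ω r) := by
        have hm := fun k => (h.aemeasurable_decayKernel (1 - 1 / (n k : ℝ))).ennreal_ofReal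
        rw [lintegral_const_mul' _ _ hC, lintegral_tsum fun k => (hm k).const_mul _]
        congr 2
        ext k
        rw [lintegral_const_mul'' _ (hm k)]
    _ ≤ C * ∑' k, ‖a k‖ₑ ^ q * ENNReal.ofReal (3 * tailIntegral ω (1 - 1 / (n k : ℝ))) := by
        gcongr with k
        exact h.lintegral_decayKernel_le (hs k)
    _ = _ := by
        rw [tailSum, mul_assoc, ← ENNReal.tsum_mul_left (a := 3)]
        congr 2
        ext k
        rw [ENNReal.ofReal_mul (by norm_num), ENNReal.ofReal_ofNat]
        ring

/-! ### Moments of the weight -/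

lemma ofReal_moment (h : IsDoublingWeight ω β) (m : ℕ) :
    ENNReal.ofReal (∫ r in (0 : ℝ)..1, r ^ m * ω r) =
      ∫⁻ r in Ioo (0 : ℝ) 1, ENNReal.ofReal (r ^ m * ω r) := by
  have hI : IntervalIntegrable (fun r => r ^ m * ω r) volume 0 1 :=
    (h.intervalIntegrable (left_mem_Icc.2 zero_le_one) (right_mem_Icc.2 zero_le_one)).continuousOn_mul
      (by fun_prop)
  rw [intervalIntegrable_iff_integrableOn_Ioo_of_le zero_le_one] at hI
  rw [intervalIntegral.integral_of_le zero_le_one, integral_Ioc_eq_integral_Ioo,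
    ofReal_integral_eq_lintegral_ofReal hI]
  filter_upwards [ae_restrict_mem measurableSet_Ioo] with r hr
  have := h.pos r ⟨hr.1.le, hr.2⟩
  have := hr.1
  positivity

/-- The kernel estimate with q = 1, after r^{2n+1} ≤ r^n; the minimum factor is at most 1 and is
dropped. -/
lemma exists_moment_le (h : IsDoublingWeight ω β) : ∃ C : ℝ≥0∞, C ≠ ∞ ∧ ∀ n : ℕ, 1 ≤ n →
    ENNReal.ofReal (∫ r in (0 : ℝ)..1, r ^ (2 * n + 1) * ω r) ≤
      C * ENNReal.ofReal (tailIntegral ω (1 - 1 / (n : ℝ))) := by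
  obtain ⟨C, hC, hle⟩ := h.exists_pow_le_decayKernel one_pos
  refine ⟨ENNReal.ofReal C * 3, ENNReal.mul_ne_top ENNReal.ofReal_ne_top (by simp), fun n hn => ?_⟩
  have hs := one_sub_one_div_mem hn
  rw [h.ofReal_moment]
  calc _ ≤ ∫⁻ r in Ioo (0 : ℝ) 1, ENNReal.ofReal C *
        ENNReal.ofReal (decayKernel ω (1 - 1 / (n : ℝ)) r * ω r) := by
        refine setLIntegral_mono' measurableSet_Ioo fun r hr => ?_
        have hr' : r ∈ Ico (0 : ℝ) 1 := ⟨hr.1.le, hr.2⟩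
        have hD := h.decayKernel_nonneg (Ico_subset_Icc_self hs) (Ico_subset_Icc_self hr')
        rw [← ENNReal.ofReal_mul (by linarith)]
        refine ENNReal.ofReal_le_ofReal ?_
        have hω := h.pos r hr'
        rw [← mul_assoc]
        gcongr
        calc r ^ (2 * n + 1) ≤ r ^ n := pow_le_pow_of_le_one hr'.1 hr'.2.le (by omega)
          _ ≤ _ := hle n hn r hr'
          _ ≤ C * (decayKernel ω (1 - 1 / (n : ℝ)) r ^ (1 / (1 : ℝ)) * 1) := by
            have h1 := h.tailIntegral_pos hs
            have h2 := h.tailIntegral_pos hr'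
            gcongr
            refine Real.rpow_le_one (by positivity) ?_ (by norm_num)
            rcases le_total (tailIntegral ω (1 - 1 / (n : ℝ))) (tailIntegral ω r) with hT | hT
            · exact (min_le_left _ _).trans ((div_le_one h2).2 hT)
            · exact (min_le_right _ _).trans ((div_le_one h1).2 hT)
          _ = _ := by simp
    _ = ENNReal.ofReal C * ∫⁻ r in Ioo (0 : ℝ) 1,
        ENNReal.ofReal (decayKernel ω (1 - 1 / (n : ℝ)) r * ω r) :=
        lintegral_const_mul' _ _ ENNReal.ofReal_ne_top
    _ ≤ ENNReal.ofReal C * ENNReal.ofReal (3 * tailIntegral ω (1 - 1 / (n : ℝ))) := by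
        gcongr; exact h.lintegral_decayKernel_le hs
    _ = _ := by rw [ENNReal.ofReal_mul (by norm_num), ENNReal.ofReal_ofNat, mul_assoc]

/-- Bernoulli with exponent ⌊n/2⌋ gives 1/2; squaring, and one more factor 1 - 1/n ≥ 1/2 in case n
is odd, gives 1/8. -/
lemma one_div_eight_le_pow {n : ℕ} (hn : 2 ≤ n) : 1 / 8 ≤ (1 - 1 / (n : ℝ)) ^ n := by
  have hn' : (2 : ℝ) ≤ n := by exact_mod_cast hn
  set x := 1 - 1 / (n : ℝ) with hx
  have hinv : 1 / (n : ℝ) ≤ 1 / 2 := by gcongr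
  have hx0 : 1 / 2 ≤ x := by linarith
  have hb : 1 / 2 ≤ x ^ (n / 2) := by
    have h1 := one_add_mul_le_pow (a := -(1 / (n : ℝ))) (by linarith) (n / 2)
    have h2 : ((n / 2 : ℕ) : ℝ) ≤ (n : ℝ) / 2 := Nat.cast_div_le
    have h3 : ((n / 2 : ℕ) : ℝ) * (1 / (n : ℝ)) ≤ 1 / 2 := by
      calc _ ≤ (n : ℝ) / 2 * (1 / (n : ℝ)) := by gcongr
        _ = 1 / 2 := by field_simp
    rw [← sub_eq_add_neg, ← hx] at h1
    linarith
  calc (1 : ℝ) / 8 = 1 / 2 * (1 / 2) * (1 / 2) := by norm_num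
    _ ≤ x ^ (n / 2) * x ^ (n / 2) * x := by gcongr
    _ = x ^ (2 * (n / 2) + 1) := by ring
    _ ≤ x ^ n := pow_le_pow_of_le_one (by linarith) (by rw [hx]; simp) (by omega)

lemma tailIntegral_le_two_mul (h : IsDoublingWeight ω β) {n : ℕ} (hn : 1 ≤ n) :
    tailIntegral ω (1 - 1 / (n : ℝ)) ≤ 2 ^ β * tailIntegral ω (1 - 1 / ((2 * n : ℕ) : ℝ)) := by
  have hn0 : (1 : ℝ) ≤ n := by exact_mod_cast hn
  have hd := h.tailIntegral_le (one_sub_one_div_mem hn).1 (s := 1 - 1 / ((2 * n : ℕ) : ℝ))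
    (by gcongr; omega) (one_sub_one_div_mem (n := 2 * n) (by omega)).2
  rwa [show (1 - (1 - 1 / (n : ℝ))) / (1 - (1 - 1 / ((2 * n : ℕ) : ℝ))) = 2 by
    push_cast; field_simp; ring] at hd

/-- Only the mass beyond 1 - 1/(2n) is kept, where r^{2n+1} ≥ 1/16. Taking 2n rather than n keeps
this point at least 1/2 even for n = 1, and doubling pays for the change. -/
lemma exists_le_moment (h : IsDoublingWeight ω β) : ∃ C : ℝ≥0∞, C ≠ ∞ ∧ ∀ n : ℕ, 1 ≤ n →
    ENNReal.ofReal (tailIntegral ω (1 - 1 / (n : ℝ))) ≤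
      C * ENNReal.ofReal (∫ r in (0 : ℝ)..1, r ^ (2 * n + 1) * ω r) := by
  refine ⟨ENNReal.ofReal (2 ^ β * 16), ENNReal.ofReal_ne_top, fun n hn => ?_⟩
  have hn0 : (1 : ℝ) ≤ n := by exact_mod_cast hn
  have hs := one_sub_one_div_mem hn
  have hs' := one_sub_one_div_mem (n := 2 * n) (by omega)
  have h8 := one_div_eight_le_pow (n := 2 * n) (by omega)
  have hd := h.tailIntegral_le_two_mul hn
  have hhalf : 1 / 2 ≤ 1 - 1 / ((2 * n : ℕ) : ℝ) := by
    push_cast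
    have : 1 / (2 * (n : ℝ)) ≤ 1 / 2 := by gcongr; linarith
    linarith
  rw [h.ofReal_moment]
  set s' := 1 - 1 / ((2 * n : ℕ) : ℝ)
  have hlow : ENNReal.ofReal (1 / 16) * ENNReal.ofReal (tailIntegral ω s') ≤
      ∫⁻ r in Ioo (0 : ℝ) 1, ENNReal.ofReal (r ^ (2 * n + 1) * ω r) := by
    have hmass := h.lintegral_Ioo hs'.1 hs'.2.le le_rfl
    rw [tailIntegral_one, sub_zero] at hmass
    rw [← hmass, ← lintegral_const_mul' _ _ ENNReal.ofReal_ne_top]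
    refine le_trans ?_ (lintegral_mono_set (Ioo_subset_Ioo_left hs'.1))
    refine setLIntegral_mono' measurableSet_Ioo fun r hr => ?_
    rw [← ENNReal.ofReal_mul (by norm_num)]
    refine ENNReal.ofReal_le_ofReal ?_
    have hω := h.pos r ⟨hs'.1.trans hr.1.le, hr.2⟩
    gcongr
    calc (1 : ℝ) / 16 = 1 / 8 * (1 / 2) := by norm_num
      _ ≤ s' ^ (2 * n) * s' := by gcongr
      _ = s' ^ (2 * n + 1) := (pow_succ _ _).symm
      _ ≤ r ^ (2 * n + 1) := pow_le_pow_left₀ hs'.1 hr.1.le _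
  calc _ ≤ ENNReal.ofReal (2 ^ β * tailIntegral ω s') := ENNReal.ofReal_le_ofReal hd
    _ = ENNReal.ofReal (2 ^ β * 16) *
        (ENNReal.ofReal (1 / 16) * ENNReal.ofReal (tailIntegral ω s')) := by
        rw [← ENNReal.ofReal_mul (by norm_num), ← ENNReal.ofReal_mul (by positivity)]
        congr 1
        ring
    _ ≤ _ := by gcongr

end IsDoublingWeight

/-! ### Blocks of exponents -/

/-- A geometrically decreasing sequence meets `[A, MA]` in a bounded number of terms. -/
lemma exists_subset_Ico_of_mul_le {lam : ℝ} (hlam : 1 < lam) (M : ℝ) : ∃ N : ℕ,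
    ∀ T : ℕ → ℝ, (∀ k, lam * T (k + 1) ≤ T k) → ∀ A : ℝ, 0 < A → ∀ S : Set ℕ,
      (∀ k ∈ S, A ≤ T k ∧ T k ≤ M * A) → ∃ k₀, S ⊆ Finset.Ico k₀ (k₀ + N) := by
  obtain ⟨N, hN⟩ := pow_unbounded_of_one_lt M hlam
  refine ⟨N, fun T hT A hA S hS => ?_⟩
  have hl0 : 0 < lam := by linarith
  -- An index N or more places after the least one would force lam^N A ≤ M A.
  refine ⟨sInf S, fun k hk => ?_⟩
  have hk0 := Nat.sInf_mem ⟨k, hk⟩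
  have hle : sInf S ≤ k := Nat.sInf_le hk
  rw [Finset.coe_Ico, mem_Ico]
  refine ⟨hle, lt_of_not_ge fun hge => ?_⟩
  have h1 := pow_mul_le_of_mul_le hl0 hT (sInf S) (k - sInf S)
  rw [show sInf S + (k - sInf S) = k by omega] at h1
  have h2 : lam ^ N * A ≤ M * A := by
    calc lam ^ N * A ≤ lam ^ (k - sInf S) * T k := by
          gcongr
          · exact hlam.le
          · omega
          · exact (hS k hk).1
      _ ≤ T (sInf S) := h1
      _ ≤ M * A := (hS _ hk0).2
  have h3 := mul_lt_mul_of_pos_right hN hA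
  linarith

lemma tsum_subtype_le_of_subset_Ico {S : Set ℕ} {k₀ N : ℕ} (hS : S ⊆ Finset.Ico k₀ (k₀ + N))
    {g : ℕ → ℝ≥0∞} {c : ℝ≥0∞} (hg : ∀ k ∈ S, g k ≤ c) : ∑' k : S, g k ≤ N * c := by
  calc ∑' k : S, g k ≤ ∑' k : S, (fun _ => c) (k : ℕ) := ENNReal.tsum_le_tsum fun k => hg k k.2
    _ ≤ ∑' k : (Finset.Ico k₀ (k₀ + N) : Set ℕ), (fun _ => c) (k : ℕ) :=
        ENNReal.tsum_mono_subtype (fun _ => c) hS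
    _ = N * c := by
        rw [Finset.tsum_subtype' (Finset.Ico k₀ (k₀ + N)) (fun _ => c)]
        simp

namespace IsDoublingWeight

variable {ω : ℝ → ℝ} {β α : ℝ}

lemma blockRadius_mem (h : IsDoublingWeight ω β) (hα : 0 < α) (m : ℕ) :
    blockRadius ω α m ∈ Ico (0 : ℝ) 1 :=
  (blockRadius_spec h.toIsContinuousRadialWeight h.integral_eq_one hα m).1.1

lemma tailIntegral_blockRadius (h : IsDoublingWeight ω β) (hα : 0 < α) (m : ℕ) :
    tailIntegral ω (blockRadius ω α m) = (2 : ℝ) ^ (-(m * α)) :=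
  (blockRadius_spec h.toIsContinuousRadialWeight h.integral_eq_one hα m).1.2

lemma monotone_blockStart (h : IsDoublingWeight ω β) (hα : 0 < α) :
    Monotone (blockStart ω α) := by
  intro m m' hmm
  have h1 := h.blockRadius_mem hα m
  have h2 := h.blockRadius_mem hα m'
  have hle : blockRadius ω α m ≤ blockRadius ω α m' := by
    refine (h.strictAntiOn_tailIntegral.le_iff_ge (Ico_subset_Icc_self h2)
      (Ico_subset_Icc_self h1)).1 ?_
    rw [h.tailIntegral_blockRadius hα, h.tailIntegral_blockRadius hα]
    gcongr
    exact one_le_two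
  refine Nat.floor_mono ?_
  have : 0 < 1 - blockRadius ω α m' := by linarith [h2.2]
  gcongr

lemma exists_lt_blockStart (h : IsDoublingWeight ω β) (hα : 0 < α) (n : ℕ) :
    ∃ m, n < blockStart ω α (m + 1) := by
  have hs := one_sub_one_div_mem (n := n + 1) (by omega)
  obtain ⟨m, hm⟩ := exists_pow_lt_of_lt_one (h.tailIntegral_pos hs)
    (Real.rpow_lt_one_of_one_lt_of_neg one_lt_two (neg_lt_zero.2 hα))
  refine ⟨m, ?_⟩
  have hr := h.blockRadius_mem hα (m + 1)
  have h1 : (2 : ℝ) ^ (-(((m + 1 : ℕ) : ℝ) * α)) < tailIntegral ω (1 - 1 / ((n + 1 : ℕ) : ℝ)) := by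
    refine lt_of_le_of_lt ?_ hm
    rw [← Real.rpow_natCast, ← Real.rpow_mul zero_le_two]
    refine Real.rpow_le_rpow_of_exponent_le one_le_two ?_
    push_cast
    nlinarith
  rw [← h.tailIntegral_blockRadius hα, h.strictAntiOn_tailIntegral.lt_iff_gt
    (Ico_subset_Icc_self hr) (Ico_subset_Icc_self hs)] at h1
  rw [← Nat.succ_le_iff, blockStart, Nat.le_floor_iff' (by omega), le_div_iff₀ (by linarith [hr.2])]
  have h2 : 1 - blockRadius ω α (m + 1) ≤ 1 / ((n + 1 : ℕ) : ℝ) := by linarith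
  rwa [le_div_iff₀ (by positivity), mul_comm] at h2

lemma exists_mem_block (h : IsDoublingWeight ω β) (hα : 0 < α) (n : ℕ) :
    ∃ m, n ∈ block ω α m := by
  classical
  have hex := h.exists_lt_blockStart hα n
  have hlt := Nat.find_spec hex
  refine ⟨Nat.find hex, ?_⟩
  rcases hm : Nat.find hex with _ | m
  · rwa [hm] at hlt
  · rw [hm] at hlt
    exact ⟨not_lt.1 (Nat.find_min hex (m := m) (by omega)), hlt⟩

lemma lt_of_mem_block {n m : ℕ} (hn : n ∈ block ω α m) : n < blockStart ω α (m + 1) := by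
  cases m with
  | zero => exact hn
  | succ m => exact hn.2

lemma eq_of_mem_block (h : IsDoublingWeight ω β) (hα : 0 < α) {n m m' : ℕ}
    (hm : n ∈ block ω α m) (hm' : n ∈ block ω α m') : m = m' := by
  have key : ∀ {i j : ℕ}, n ∈ block ω α i → n ∈ block ω α j → ¬ i < j := by
    intro i j hi hj hij
    obtain ⟨j, rfl⟩ := Nat.exists_eq_succ_of_ne_zero (by omega : j ≠ 0)
    have h1 := lt_of_mem_block hi
    have h2 := h.monotone_blockStart hα (show i + 1 ≤ j + 1 by omega)
    have h3 : blockStart ω α (j + 1) ≤ n := hj.1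
    omega
  have h1 := key hm hm'
  have h2 := key hm' hm
  omega

lemma le_tailIntegral_of_mem_block (h : IsDoublingWeight ω β) (hα : 0 < α) {n m : ℕ} (hn : 1 ≤ n)
    (hm : n ∈ block ω α m) :
    (2 : ℝ) ^ (-α) * (2 : ℝ) ^ (-(m * α)) ≤ tailIntegral ω (1 - 1 / (n : ℝ)) := by
  have hs := one_sub_one_div_mem hn
  have hr := h.blockRadius_mem hα (m + 1)
  have hn0 : (0 : ℝ) < n := by exact_mod_cast hn
  have h1 := lt_of_mem_block hm
  rw [← Real.rpow_add two_pos, show -α + -(m * α) = -(((m + 1 : ℕ) : ℝ) * α) by push_cast; ring,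
    ← h.tailIntegral_blockRadius hα]
  refine h.strictAntiOn_tailIntegral.antitoneOn (Ico_subset_Icc_self hs) (Ico_subset_Icc_self hr) ?_
  have h2 : (n : ℝ) ≤ 1 / (1 - blockRadius ω α (m + 1)) := by
    refine (Nat.cast_le.2 h1.le).trans (Nat.floor_le ?_)
    have : 0 < 1 - blockRadius ω α (m + 1) := by linarith [hr.2]
    positivity
  rw [le_div_iff₀ (by linarith [hr.2]), mul_comm, ← le_div_iff₀ hn0] at h2
  linarith

/-- Because M_m is an integer part, membership yields only 1/(1 - r_m) < n + 1 ≤ 2n, so r_m is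
compared with 1 - 1/(2n) and doubling costs 2^β. Block 0 has no lower bound on n, but r_0 = 0. -/
lemma tailIntegral_le_of_mem_block (h : IsDoublingWeight ω β) (hα : 0 < α) {n m : ℕ} (hn : 1 ≤ n)
    (hm : n ∈ block ω α m) :
    tailIntegral ω (1 - 1 / (n : ℝ)) ≤ 2 ^ β * (2 : ℝ) ^ (-(m * α)) := by
  have hs' := one_sub_one_div_mem (n := 2 * n) (by omega)
  have hr := h.blockRadius_mem hα m
  refine (h.tailIntegral_le_two_mul hn).trans ?_
  rw [← h.tailIntegral_blockRadius hα]
  gcongr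
  refine h.strictAntiOn_tailIntegral.antitoneOn (Ico_subset_Icc_self hr)
    (Ico_subset_Icc_self hs') ?_
  have hn0 : (1 : ℝ) ≤ n := by exact_mod_cast hn
  cases m with
  | zero =>
    have : blockRadius ω α 0 = 0 := by
      refine h.strictAntiOn_tailIntegral.injOn (Ico_subset_Icc_self hr)
        (left_mem_Icc.2 zero_le_one) ?_
      rw [h.tailIntegral_blockRadius hα, h.tailIntegral_zero]
      simp
    rw [this]
    exact hs'.1
  | succ m =>
    have h1 : blockStart ω α (m + 1) ≤ n := hm.1
    have h2 := Nat.lt_of_floor_lt (Nat.lt_succ_of_le h1)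
    have hr1 : 0 < 1 - blockRadius ω α (m + 1) := by linarith [hr.2]
    rw [div_lt_iff₀ hr1] at h2
    have h3 : 1 / ((2 * n : ℕ) : ℝ) ≤ 1 - blockRadius ω α (m + 1) := by
      rw [div_le_iff₀ (by positivity)]
      push_cast at h2 ⊢
      nlinarith
    linarith

/-- Each block contains a bounded number of exponents of an `ω`-lacunary series. -/
lemma exists_block_subset_Ico (h : IsDoublingWeight ω β) (hα : 0 < α) {lam : ℝ} (hlam : 1 < lam) :
    ∃ N : ℕ, ∀ (f : ℂ → ℂ) (a : ℕ → ℂ) (n : ℕ → ℕ), IsLacunarySeries ω lam f a n →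
      ∀ m, ∃ k₀, {k | n k ∈ block ω α m} ⊆ Finset.Ico k₀ (k₀ + N) := by
  obtain ⟨N, hN⟩ := exists_subset_Ico_of_mul_le hlam ((2 : ℝ) ^ β * 2 ^ α)
  refine ⟨N, fun f a n hf m => hN _ (hf.mul_tailIntegral_le h)
    ((2 : ℝ) ^ (-α) * (2 : ℝ) ^ (-(m * α))) (by positivity) _ fun k hk =>
      ⟨h.le_tailIntegral_of_mem_block hα (hf.one_le k) hk, ?_⟩⟩
  refine (h.tailIntegral_le_of_mem_block hα (hf.one_le k) hk).trans_eq ?_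
  rw [Real.rpow_neg zero_le_two α]
  field_simp

lemma tsum_block (h : IsDoublingWeight ω β) (hα : 0 < α) (n : ℕ → ℕ) (g : ℕ → ℝ≥0∞) :
    ∑' m, ∑' k : {k | n k ∈ block ω α m}, g k = ∑' k, g k := by
  choose b hb using fun k => h.exists_mem_block hα (n k)
  rw [← ENNReal.tsum_fiberwise g b]
  congr 1
  ext m
  have : {k | n k ∈ block ω α m} = b ⁻¹' {m} := by
    ext k
    simp only [mem_ofPred_eq, mem_preimage, mem_singleton_iff]
    exact ⟨fun hk => h.eq_of_mem_block hα (hb k) hk, fun hk => hk ▸ hb k⟩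
  rw [this]

/-- In a block of at most N exponents, each |a_k|^s is bounded by the 1/t-th power of the block's
sum of |a_k|^q, since st = q. -/
theorem exists_blockSum_le_tailSum (h : IsDoublingWeight ω β) (hα : 0 < α) {lam q s t : ℝ}
    (hlam : 1 < lam) (ht : 0 < t) (hst : s * t = q) :
    ∃ C : ℝ≥0∞, C ≠ ∞ ∧ ∀ (f : ℂ → ℂ) (a : ℕ → ℂ) (n : ℕ → ℕ), IsLacunarySeries ω lam f a n →
      blockSum ω α a n s t ≤ C * tailSum ω a n q := by
  obtain ⟨N, hN⟩ := h.exists_block_subset_Ico hα hlam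
  refine ⟨ENNReal.ofReal (2 ^ α) * (N : ℝ≥0∞) ^ t, ENNReal.mul_ne_top ENNReal.ofReal_ne_top
    (ENNReal.rpow_ne_top_of_nonneg ht.le (by simp)), fun f a n hf => ?_⟩
  rw [tailSum, ← h.tsum_block hα n, ← ENNReal.tsum_mul_left]
  refine ENNReal.tsum_le_tsum fun m => ?_
  obtain ⟨k₀, hk₀⟩ := hN f a n hf m
  set S := {k | n k ∈ block ω α m}
  have h1 : ∑' k : S, ‖a k‖ₑ ^ s ≤ N * (∑' k : S, ‖a k‖ₑ ^ q) ^ (1 / t) := by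
    refine tsum_subtype_le_of_subset_Ico (g := fun k => ‖a k‖ₑ ^ s) hk₀ fun k hk => ?_
    calc ‖a k‖ₑ ^ s = (‖a k‖ₑ ^ q) ^ (1 / t) := by
          rw [← ENNReal.rpow_mul, ← hst]; field_simp
      _ ≤ _ := by gcongr; exact ENNReal.le_tsum (f := fun k : S => ‖a k‖ₑ ^ q) ⟨k, hk⟩
  calc _ ≤ ENNReal.ofReal ((2 : ℝ) ^ (-(m * α))) *
        (N * (∑' k : S, ‖a k‖ₑ ^ q) ^ (1 / t)) ^ t := by gcongr; exact h1
    _ = (N : ℝ≥0∞) ^ t * ∑' k : S, ‖a k‖ₑ ^ q * ENNReal.ofReal ((2 : ℝ) ^ (-(m * α))) := by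
        rw [ENNReal.mul_rpow_of_nonneg _ _ ht.le, ← ENNReal.rpow_mul, one_div_mul_cancel ht.ne',
          ENNReal.rpow_one, ENNReal.tsum_mul_right]
        ring
    _ ≤ (N : ℝ≥0∞) ^ t * ∑' k : S, ‖a k‖ₑ ^ q *
        (ENNReal.ofReal (2 ^ α) * ENNReal.ofReal (tailIntegral ω (1 - 1 / (n k : ℝ)))) := by
        gcongr with k
        rw [← ENNReal.ofReal_mul (by positivity)]
        refine ENNReal.ofReal_le_ofReal ?_
        have := h.le_tailIntegral_of_mem_block hα (hf.one_le k) k.2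
        rwa [Real.rpow_neg zero_le_two α, inv_mul_le_iff₀ (by positivity)] at this
    _ = _ := by
        rw [← ENNReal.tsum_mul_left, ← ENNReal.tsum_mul_left]
        congr 1
        ext k
        ring

theorem exists_tailSum_le_blockSum (h : IsDoublingWeight ω β) (hα : 0 < α) {lam q s t : ℝ}
    (hlam : 1 < lam) (ht : 0 < t) (hst : s * t = q) :
    ∃ C : ℝ≥0∞, C ≠ ∞ ∧ ∀ (f : ℂ → ℂ) (a : ℕ → ℂ) (n : ℕ → ℕ), IsLacunarySeries ω lam f a n →
      tailSum ω a n q ≤ C * blockSum ω α a n s t := by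
  obtain ⟨N, hN⟩ := h.exists_block_subset_Ico hα hlam
  refine ⟨N * ENNReal.ofReal (2 ^ β), ENNReal.mul_ne_top (by simp) ENNReal.ofReal_ne_top,
    fun f a n hf => ?_⟩
  rw [tailSum, ← h.tsum_block hα n, blockSum, ← ENNReal.tsum_mul_left]
  refine ENNReal.tsum_le_tsum fun m => ?_
  obtain ⟨k₀, hk₀⟩ := hN f a n hf m
  rw [mul_assoc]
  refine tsum_subtype_le_of_subset_Ico (g := fun k => ‖a k‖ₑ ^ q *
    ENNReal.ofReal (tailIntegral ω (1 - 1 / (n k : ℝ)))) hk₀ fun k hk => ?_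
  calc _ ≤ ‖a k‖ₑ ^ q * (ENNReal.ofReal (2 ^ β) * ENNReal.ofReal ((2 : ℝ) ^ (-(m * α)))) := by
        gcongr
        rw [← ENNReal.ofReal_mul (by positivity)]
        exact ENNReal.ofReal_le_ofReal (h.tailIntegral_le_of_mem_block hα (hf.one_le k) hk)
    _ = ENNReal.ofReal (2 ^ β) * (ENNReal.ofReal ((2 : ℝ) ^ (-(m * α))) * (‖a k‖ₑ ^ s) ^ t) := by
        rw [← ENNReal.rpow_mul, hst]; ring
    _ ≤ _ := by
        gcongr
        exact ENNReal.le_tsum (f := fun k : {k // n k ∈ block ω α m} => ‖a k‖ₑ ^ s) ⟨k, hk⟩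

theorem exists_momentSum_le_tailSum (h : IsDoublingWeight ω β) (q lam : ℝ) :
    ∃ C : ℝ≥0∞, C ≠ ∞ ∧ ∀ (f : ℂ → ℂ) (a : ℕ → ℂ) (n : ℕ → ℕ), IsLacunarySeries ω lam f a n →
      momentSum ω a n q ≤ C * tailSum ω a n q := by
  obtain ⟨C, hC, hle⟩ := h.exists_moment_le
  refine ⟨C, hC, fun f a n hf => ?_⟩
  rw [tailSum, ← ENNReal.tsum_mul_left]
  refine ENNReal.tsum_le_tsum fun k => ?_
  rw [mul_left_comm]
  gcongr
  exact hle (n k) (hf.one_le k)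

theorem exists_tailSum_le_momentSum (h : IsDoublingWeight ω β) (q lam : ℝ) :
    ∃ C : ℝ≥0∞, C ≠ ∞ ∧ ∀ (f : ℂ → ℂ) (a : ℕ → ℂ) (n : ℕ → ℕ), IsLacunarySeries ω lam f a n →
      tailSum ω a n q ≤ C * momentSum ω a n q := by
  obtain ⟨C, hC, hle⟩ := h.exists_le_moment
  refine ⟨C, hC, fun f a n hf => ?_⟩
  rw [momentSum, ← ENNReal.tsum_mul_left]
  refine ENNReal.tsum_le_tsum fun k => ?_
  rw [mul_left_comm]
  gcongr
  exact hle (n k) (hf.one_le k)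

end IsDoublingWeight

/-! ### Parseval's identity and the Paley–Zygmund argument -/

open scoped ComplexConjugate

lemma integral_exp_sub_mul_I (M N : ℕ) :
    ∫ θ in (0 : ℝ)..2 * Real.pi, Complex.exp (M * θ * Complex.I) *
      conj (Complex.exp (N * θ * Complex.I)) = if M = N then 2 * Real.pi else 0 := by
  have e : ∀ θ : ℝ, Complex.exp (M * θ * Complex.I) * conj (Complex.exp (N * θ * Complex.I)) =
      Complex.exp ((((M : ℂ) - N) * Complex.I) * θ) := by
    intro θ
    rw [← Complex.exp_conj, ← Complex.exp_add]
    simp only [map_mul, Complex.conj_I, Complex.conj_ofReal, map_natCast]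
    congr 1
    ring
  simp_rw [e]
  split_ifs with h
  · subst h; simp
  · have hc : ((M : ℂ) - N) * Complex.I ≠ 0 :=
      mul_ne_zero (sub_ne_zero.2 (by exact_mod_cast h)) Complex.I_ne_zero
    rw [integral_exp_mul_complex hc]
    have : Complex.exp (((M : ℂ) - N) * Complex.I * ((2 * Real.pi : ℝ) : ℂ)) = 1 := by
      rw [← Complex.exp_int_mul_two_pi_mul_I ((M : ℤ) - N)]
      congr 1
      push_cast
      ring
    rw [this]
    simp

lemma norm_exp_nat_mul_I (N : ℕ) (θ : ℝ) : ‖Complex.exp (N * θ * Complex.I)‖ = 1 := by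
  have := Complex.norm_exp_ofReal_mul_I (N * θ)
  simpa using this

lemma hasSum_mul_of_summable_norm {ι : Type*} {u v : ι → ℂ} {s t : ℂ}
    (hu : Summable fun i => ‖u i‖) (hv : Summable fun i => ‖v i‖) (hs : HasSum u s)
    (ht : HasSum v t) : HasSum (fun x : ι × ι => u x.1 * v x.2) (s * t) := by
  have h : Summable fun x : ι × ι => u x.1 * v x.2 :=
    summable_mul_of_summable_norm (f := u) (g := v) hu hv
  exact HasSum.mul (f := u) (g := v) hs ht h

lemma hasSum_integral_mul_conj {ι : Type*} [Countable ι] {u : ι → ℝ → ℂ} {g : ℝ → ℂ} {B : ι → ℝ}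
    (L : ℝ) (hB : Summable B) (hB0 : ∀ i, 0 ≤ B i) (hu : ∀ i, Continuous (u i))
    (huB : ∀ i θ, ‖u i θ‖ ≤ B i) (hg : ∀ θ, HasSum (fun i => u i θ) (g θ)) :
    HasSum (fun x : ι × ι => ∫ θ in (0 : ℝ)..L, u x.1 θ * conj (u x.2 θ))
      (∫ θ in (0 : ℝ)..L, g θ * conj (g θ)) := by
  have hS : ∀ θ : ℝ, Summable fun i => ‖u i θ‖ := fun θ =>
    hB.of_nonneg_of_le (fun _ => norm_nonneg _) fun i => huB i θ
  have hbd : Summable fun x : ι × ι => B x.1 * B x.2 := Summable.mul_of_nonneg hB hB hB0 hB0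
  refine intervalIntegral.hasSum_integral_of_dominated_convergence
    (bound := fun x _ => B x.1 * B x.2) ?_ ?_ ?_ ?_ ?_
  · exact fun x => ((hu x.1).mul (Complex.continuous_conj.comp (hu x.2))).aestronglyMeasurable
  · refine fun x => Eventually.of_forall fun θ _ => ?_
    rw [norm_mul, RCLike.norm_conj]
    exact mul_le_mul (huB _ _) (huB _ _) (norm_nonneg _) (hB0 _)
  · exact Eventually.of_forall fun θ _ => hbd
  · exact intervalIntegrable_const
  · have h2 : ∀ θ, HasSum (fun x : ι × ι => u x.1 θ * conj (u x.2 θ)) (g θ * conj (g θ)) :=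
      fun θ => hasSum_mul_of_summable_norm (u := fun i => u i θ) (v := fun i => conj (u i θ))
        (hS θ) (by simpa only [RCLike.norm_conj] using hS θ) (hg θ) (Complex.hasSum_conj'.2 (hg θ))
    exact Eventually.of_forall fun θ _ => h2 θ

/-- Parseval's identity for absolutely convergent trigonometric series, with frequencies possibly
repeated. -/
lemma hasSum_integral_normSq {ι : Type*} [Countable ι] {b : ι → ℂ} {N : ι → ℕ} {g : ℝ → ℂ}
    (hb : Summable fun i => ‖b i‖)
    (hg : ∀ θ : ℝ, HasSum (fun i => b i * Complex.exp (N i * θ * Complex.I)) (g θ)) :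
    HasSum (fun x : ι × ι => if N x.1 = N x.2 then b x.1 * conj (b x.2) * (2 * Real.pi) else 0)
      ((∫ θ in (0 : ℝ)..2 * Real.pi, ‖g θ‖ ^ 2 : ℝ) : ℂ) := by
  have hsq : ∀ θ, ((‖g θ‖ ^ 2 : ℝ) : ℂ) = g θ * conj (g θ) := by
    intro θ; rw [Complex.mul_conj, Complex.normSq_eq_norm_sq]
  rw [← intervalIntegral.integral_ofReal]
  simp_rw [hsq]
  have h := hasSum_integral_mul_conj
    (u := fun i (θ : ℝ) => b i * Complex.exp (N i * θ * Complex.I)) (2 * Real.pi) hb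
    (fun _ => norm_nonneg _) (fun i => by fun_prop)
    (fun i θ => by rw [norm_mul, norm_exp_nat_mul_I, mul_one]) hg
  convert h using 2 with x
  have e : ∀ θ : ℝ, b x.1 * Complex.exp (N x.1 * θ * Complex.I) *
      conj (b x.2 * Complex.exp (N x.2 * θ * Complex.I)) = b x.1 * conj (b x.2) *
      (Complex.exp (N x.1 * θ * Complex.I) * conj (Complex.exp (N x.2 * θ * Complex.I))) := by
    intro θ; rw [map_mul]; ring
  simp_rw [e]
  rw [intervalIntegral.integral_const_mul, integral_exp_sub_mul_I]
  split_ifs <;> simp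

lemma integral_normSq_of_injective {ι : Type*} [Countable ι] {b : ι → ℂ} {N : ι → ℕ} {g : ℝ → ℂ}
    (hN : Function.Injective N) (hb : Summable fun i => ‖b i‖)
    (hg : ∀ θ : ℝ, HasSum (fun i => b i * Complex.exp (N i * θ * Complex.I)) (g θ)) :
    HasSum (fun i => ‖b i‖ ^ 2 * (2 * Real.pi)) (∫ θ in (0 : ℝ)..2 * Real.pi, ‖g θ‖ ^ 2) := by
  have h := hasSum_integral_normSq hb hg
  have hd : Function.Injective (fun i : ι => (i, i)) := fun i j hij => congrArg Prod.fst hij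
  rw [← hd.hasSum_iff] at h
  · rw [← Complex.hasSum_ofReal]
    convert h using 2 with i
    simp only [Function.comp_apply, if_true]
    rw [Complex.mul_conj, Complex.normSq_eq_norm_sq]
    push_cast
    ring
  · rintro ⟨i, j⟩ hij
    refine if_neg fun h => hij ⟨i, ?_⟩
    have : i = j := hN h
    simp [this]

/-- In the double series only pairs with equal frequency survive. Bounding |b_i b_j| by |b_i|² +
|b_j|², each index is met at most K times on either side. It is meant for f², indexed by pairs with
frequency n_i + n_j. -/
lemma enorm_integral_normSq_le {ι : Type*} [Countable ι] {b : ι → ℂ} {N : ι → ℕ} {g : ℝ → ℂ}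
    {K : ℝ≥0∞} (hN : ∀ M, ∑' i, (if N i = M then 1 else 0 : ℝ≥0∞) ≤ K)
    (hb : Summable fun i => ‖b i‖)
    (hg : ∀ θ : ℝ, HasSum (fun i => b i * Complex.exp (N i * θ * Complex.I)) (g θ)) :
    ENNReal.ofReal (∫ θ in (0 : ℝ)..2 * Real.pi, ‖g θ‖ ^ 2) ≤
      ENNReal.ofReal (2 * Real.pi) * (2 * K * ∑' i, ‖b i‖ₑ ^ 2) := by
  have h := hasSum_integral_normSq hb hg
  have hmul : ∀ x y : ℝ≥0∞, x * y ≤ x ^ 2 + y ^ 2 := by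
    intro x y
    rcases le_total x y with hxy | hxy
    · calc x * y ≤ y * y := by gcongr
        _ = y ^ 2 := (sq y).symm
        _ ≤ _ := le_add_self
    · calc x * y ≤ x * x := by gcongr
        _ = x ^ 2 := (sq x).symm
        _ ≤ _ := le_self_add
  have hpi : ‖(2 * Real.pi : ℂ)‖ₑ = ENNReal.ofReal (2 * Real.pi) := by
    rw [← ofReal_norm]
    congr 1
    simp [abs_of_pos Real.pi_pos]
  calc ENNReal.ofReal (∫ θ in (0 : ℝ)..2 * Real.pi, ‖g θ‖ ^ 2)
      ≤ ‖((∫ θ in (0 : ℝ)..2 * Real.pi, ‖g θ‖ ^ 2 : ℝ) : ℂ)‖ₑ := by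
        rw [← ofReal_norm]
        refine ENNReal.ofReal_le_ofReal ?_
        rw [Complex.norm_real]
        exact le_abs_self _
    _ ≤ ∑' x : ι × ι, ‖if N x.1 = N x.2 then b x.1 * conj (b x.2) * (2 * Real.pi) else 0‖ₑ := by
        rw [← h.tsum_eq]
        exact enorm_tsum_le_tsum_enorm
    _ ≤ ∑' x : ι × ι, (ENNReal.ofReal (2 * Real.pi) *
          (‖b x.1‖ₑ ^ 2 * (if N x.2 = N x.1 then 1 else 0)) +
          ENNReal.ofReal (2 * Real.pi) * (‖b x.2‖ₑ ^ 2 * (if N x.1 = N x.2 then 1 else 0))) := by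
        refine ENNReal.tsum_le_tsum fun x => ?_
        by_cases hx : N x.1 = N x.2
        · rw [if_pos hx, if_pos hx.symm, if_pos hx, enorm_mul, enorm_mul, RCLike.enorm_conj, hpi,
            mul_one, mul_one, ← mul_add, mul_comm]
          gcongr
          exact hmul _ _
        · rw [if_neg hx]; simp
    _ ≤ ENNReal.ofReal (2 * Real.pi) * (∑' i, ‖b i‖ₑ ^ 2 * K) +
        ENNReal.ofReal (2 * Real.pi) * (∑' i, ‖b i‖ₑ ^ 2 * K) := by
        rw [ENNReal.tsum_add, ENNReal.tsum_mul_left, ENNReal.tsum_mul_left]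
        refine add_le_add ?_ ?_
        · gcongr
          rw [ENNReal.tsum_prod']
          refine ENNReal.tsum_le_tsum fun i => ?_
          dsimp only
          rw [ENNReal.tsum_mul_left]
          gcongr
          exact hN _
        · gcongr
          rw [ENNReal.tsum_prod', ENNReal.tsum_comm]
          refine ENNReal.tsum_le_tsum fun i => ?_
          dsimp only
          rw [ENNReal.tsum_mul_left]
          gcongr
          exact hN _
    _ = _ := by rw [ENNReal.tsum_mul_right]; ring

/-- The Paley–Zygmund argument: a function whose fourth moment is controlled by its second moment
is large on a large set. -/
lemma le_volume_of_integral_pow_four_le {F : ℝ → ℝ} (hF : Continuous F) {A K L : ℝ} (hA : 0 < A)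
    (hK : 0 < K) (hL : 0 < L) (h2 : ∫ θ in (0 : ℝ)..L, F θ ^ 2 = L * A)
    (h4 : ∫ θ in (0 : ℝ)..L, F θ ^ 4 ≤ L * (K * A ^ 2)) :
    ENNReal.ofReal (L / (4 * K)) ≤ volume ({θ | A / 2 ≤ F θ ^ 2} ∩ Icc 0 L) := by
  set E := {θ | A / 2 ≤ F θ ^ 2} with hE
  have hEm : MeasurableSet E := (isClosed_le continuous_const (hF.pow 2)).measurableSet
  rw [intervalIntegral.integral_of_le hL.le, ← integral_Icc_eq_integral_Ioc] at h2 h4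
  have hI : ∀ m : ℕ, IntegrableOn (fun θ => F θ ^ m) (Icc 0 L) := fun m =>
    (hF.pow m).continuousOn.integrableOn_compact isCompact_Icc
  have hIE : IntegrableOn (E.indicator fun _ => K * A) (Icc 0 L) :=
    (integrableOn_const (by simp)).indicator hEm
  -- On E this is the arithmetic–geometric mean inequality, off E the definition of E. The weights
  -- are chosen so that the fourth moment costs LA/4; with LA/2 from the constant term, LA/4 is left
  -- for |E| K A.
  have hpt : ∀ θ, F θ ^ 2 ≤ A / 2 + E.indicator (fun _ => K * A) θ + 1 / (4 * (K * A)) * F θ ^ 4 := by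
    intro θ
    by_cases hθ : θ ∈ E
    · rw [indicator_of_mem hθ]
      have : F θ ^ 2 ≤ K * A + 1 / (4 * (K * A)) * F θ ^ 4 := by
        have h0 : 0 < K * A := by positivity
        have : K * A + 1 / (4 * (K * A)) * F θ ^ 4 - F θ ^ 2 =
            1 / (4 * (K * A)) * (F θ ^ 2 - 2 * (K * A)) ^ 2 := by
          field_simp
          ring
        have h1 : 0 ≤ 1 / (4 * (K * A)) * (F θ ^ 2 - 2 * (K * A)) ^ 2 := by positivity
        linarith
      linarith
    · rw [indicator_of_notMem hθ]
      have : F θ ^ 2 < A / 2 := not_le.1 hθ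
      have : 0 ≤ 1 / (4 * (K * A)) * F θ ^ 4 := by positivity
      linarith
  have hIc : IntegrableOn (fun _ => A / 2) (Icc 0 L) := integrableOn_const (by simp)
  have hint := setIntegral_mono (μ := volume) (s := Icc 0 L) (hI 2)
    ((hIc.add hIE).add ((hI 4).const_mul _)) hpt
  rw [h2] at hint
  have hc : ∫ _ in Icc (0 : ℝ) L, A / 2 = L * (A / 2) := by
    simp [hL.le]
  have hsum : ∫ θ in Icc 0 L, (A / 2 + E.indicator (fun _ => K * A) θ +
      1 / (4 * (K * A)) * F θ ^ 4) = L * (A / 2) + volume.real (E ∩ Icc 0 L) * (K * A) +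
      1 / (4 * (K * A)) * ∫ θ in Icc 0 L, F θ ^ 4 := by
    rw [integral_add (f := fun θ => A / 2 + E.indicator (fun _ => K * A) θ)
        (hIc.add hIE) ((hI 4).const_mul _),
      integral_add hIc hIE, hc, integral_const_mul,
      integral_indicator hEm, Measure.restrict_restrict hEm, setIntegral_const, smul_eq_mul]
  have hint' : L * A ≤ L * (A / 2) + volume.real (E ∩ Icc 0 L) * (K * A) +
      1 / (4 * (K * A)) * (L * (K * A ^ 2)) := by
    refine hint.trans (hsum.le.trans ?_)
    gcongr
  have e : 1 / (4 * (K * A)) * (L * (K * A ^ 2)) = L * A / 4 := by field_simp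
  rw [e] at hint'
  refine ENNReal.ofReal_le_of_le_toReal ?_
  change _ ≤ volume.real (E ∩ Icc 0 L)
  rw [div_le_iff₀ (by positivity)]
  have : A * L ≤ A * (volume.real (E ∩ Icc 0 L) * (4 * K)) := by nlinarith
  exact le_of_mul_le_mul_left this hA

lemma tsum_ite_le_one {ι : Type*} {P : ι → Prop} [DecidablePred P]
    (hP : ∀ i j, P i → P j → i = j) : ∑' i, (if P i then 1 else 0 : ℝ≥0∞) ≤ 1 := by
  by_cases h : ∃ i, P i
  · obtain ⟨i, hi⟩ := h
    rw [tsum_eq_single i fun j hj => if_neg fun hj' => hj (hP j i hj' hi)]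
    rw [if_pos hi]
  · push Not at h
    simp [h]

lemma integralMean_ge {p : ℝ≥0∞} (hp : 0 < p) {r c : ℝ} {f : ℂ → ℂ} {B : ℝ≥0∞} {E : Set ℝ}
    (hE : MeasurableSet E) (hc : 0 < c) (hB : ∀ θ ∈ E, B ≤ ‖f (circleMap 0 r θ)‖ₑ)
    (hvol : ENNReal.ofReal (2 * Real.pi * c) ≤ volume (E ∩ Icc 0 (2 * Real.pi))) :
    B * ENNReal.ofReal c ^ (1 / p.toReal) ≤ integralMean p r f := by
  have hpi : 0 < 2 * Real.pi := by positivity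
  unfold integralMean
  split_ifs with h
  · obtain ⟨θ, hθ⟩ : (E ∩ Icc 0 (2 * Real.pi)).Nonempty := by
      refine nonempty_of_measure_ne_zero (μ := volume) (ne_of_gt (lt_of_lt_of_le ?_ hvol))
      rw [ENNReal.ofReal_pos]
      positivity
    -- For p = ∞ the conventions `∞.toReal = 0` and `1 / 0 = 0` turn the measure factor into 1.
    rw [h, ENNReal.toReal_top, div_zero, ENNReal.rpow_zero, mul_one]
    exact (hB θ hθ.1).trans (le_iSup₂ (f := fun θ (_ : θ ∈ Icc (0 : ℝ) (2 * Real.pi)) =>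
      ‖f (circleMap 0 r θ)‖ₑ) θ hθ.2)
  · have hp' : 0 < p.toReal := ENNReal.toReal_pos hp.ne' h
    have hone : ENNReal.ofReal (1 / (2 * Real.pi)) * ENNReal.ofReal (2 * Real.pi * c) =
        ENNReal.ofReal c := by
      rw [← ENNReal.ofReal_mul (by positivity)]
      congr 1
      field_simp
    calc B * ENNReal.ofReal c ^ (1 / p.toReal)
        = (B ^ p.toReal * ENNReal.ofReal c) ^ (1 / p.toReal) := by
          rw [ENNReal.mul_rpow_of_nonneg _ _ (by positivity), ← ENNReal.rpow_mul,
            mul_one_div_cancel hp'.ne', ENNReal.rpow_one]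
      _ ≤ _ := by
          refine ENNReal.rpow_le_rpow ?_ (by positivity)
          rw [← hone, mul_left_comm]
          gcongr
          calc _ ≤ B ^ p.toReal * volume (E ∩ Icc 0 (2 * Real.pi)) := by gcongr
            _ = ∫⁻ _ in E ∩ Icc 0 (2 * Real.pi), B ^ p.toReal := (setLIntegral_const _ _).symm
            _ ≤ ∫⁻ θ in E ∩ Icc 0 (2 * Real.pi), ‖f (circleMap 0 r θ)‖ₑ ^ p.toReal := by
                refine setLIntegral_mono' (hE.inter measurableSet_Icc) fun θ hθ => ?_
                gcongr
                exact hB θ hθ.1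
            _ ≤ _ := lintegral_mono_set inter_subset_right

/-! ### Lower estimate of the mixed norm -/

namespace IsDoublingWeight

variable {ω : ℝ → ℝ} {β : ℝ}

/-- The number of representations of an integer as a sum of two exponents of an `ω`-lacunary
series is bounded. -/
lemma exists_tsum_ite_add_eq_le (h : IsDoublingWeight ω β) {lam : ℝ} (hlam : 1 < lam) :
    ∃ N : ℕ, ∀ (f : ℂ → ℂ) (a : ℕ → ℂ) (n : ℕ → ℕ), IsLacunarySeries ω lam f a n →
      ∀ M, ∑' x : ℕ × ℕ, (if n x.1 + n x.2 = M then 1 else 0 : ℝ≥0∞) ≤ N := by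
  obtain ⟨N, hN⟩ := exists_subset_Ico_of_mul_le hlam ((2 : ℝ) ^ β)
  refine ⟨2 * N, fun f a n hf M => ?_⟩
  rcases Nat.eq_zero_or_pos M with rfl | hM
  · rw [ENNReal.tsum_eq_zero.2 fun x => if_neg (by have := hf.one_le x.1; omega)]
    exact zero_le
  have hM' := one_sub_one_div_mem hM
  -- The larger summand of M lies in [M/2, M], where ω̂(1 - 1/n) varies by a factor at most 2^β, and
  -- it determines the other summand. Either coordinate may be the larger, whence 2N.
  set W := {m | M ≤ 2 * n m ∧ n m ≤ M} with hW
  obtain ⟨k₀, hk₀⟩ := hN _ (hf.mul_tailIntegral_le h) _ (h.tailIntegral_pos hM') W fun k hk => by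
    have h1 := one_sub_one_div_mem (hf.one_le k)
    have h2 := one_sub_one_div_mem (n := 2 * n k) (by have := hf.one_le k; omega)
    have hnk : 0 < n k := hf.one_le k
    refine ⟨h.strictAntiOn_tailIntegral.antitoneOn (Ico_subset_Icc_self h1)
      (Ico_subset_Icc_self hM') ?_, (h.tailIntegral_le_two_mul (hf.one_le k)).trans ?_⟩
    · gcongr
      exact hk.2
    · gcongr
      refine h.strictAntiOn_tailIntegral.antitoneOn (Ico_subset_Icc_self hM')
        (Ico_subset_Icc_self h2) ?_
      gcongr
      exact hk.1
  have hWN : ∑' i, W.indicator (fun _ => (1 : ℝ≥0∞)) i ≤ N := by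
    rw [← tsum_subtype]
    simpa using tsum_subtype_le_of_subset_Ico (g := fun _ => 1) (c := 1) hk₀ fun _ _ => le_rfl
  have hinj := hf.strictMono.injective
  calc ∑' x : ℕ × ℕ, (if n x.1 + n x.2 = M then 1 else 0 : ℝ≥0∞)
      ≤ ∑' x : ℕ × ℕ, (W.indicator (fun _ => 1) x.1 * (if n x.1 + n x.2 = M then 1 else 0) +
        W.indicator (fun _ => 1) x.2 * (if n x.1 + n x.2 = M then 1 else 0)) := by
        refine ENNReal.tsum_le_tsum fun x => ?_
        split_ifs with hx
        · rcases le_total (n x.1) (n x.2) with hle | hle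
          · have : x.2 ∈ W := ⟨by omega, by omega⟩
            simp [this]
          · have : x.1 ∈ W := ⟨by omega, by omega⟩
            simp [this]
        · simp
    _ ≤ N + N := by
        rw [ENNReal.tsum_add]
        refine add_le_add ?_ ?_
        · rw [ENNReal.tsum_prod']
          refine le_trans (ENNReal.tsum_le_tsum fun i => ?_) hWN
          dsimp only
          rw [ENNReal.tsum_mul_left]
          refine mul_le_of_le_one_right' (tsum_ite_le_one fun j j' hj hj' => hinj ?_)
          omega
        · rw [ENNReal.tsum_prod', ENNReal.tsum_comm]
          refine le_trans (ENNReal.tsum_le_tsum fun i => ?_) hWN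
          dsimp only
          rw [ENNReal.tsum_mul_left]
          refine mul_le_of_le_one_right' (tsum_ite_le_one fun j j' hj hj' => hinj ?_)
          omega
    _ = _ := by push_cast; ring

/-- The coefficients of an `ω`-lacunary series are controlled by its integral means. -/
theorem exists_coeff_le_integralMean (h : IsDoublingWeight ω β) {p : ℝ≥0∞} (hp : 0 < p) {lam : ℝ}
    (hlam : 1 < lam) :
    ∃ C : ℝ≥0∞, C ≠ ∞ ∧ ∀ (f : ℂ → ℂ) (a : ℕ → ℂ) (n : ℕ → ℕ), IsLacunarySeries ω lam f a n →
      ∀ r ∈ Ico (0 : ℝ) 1, ∀ k, ‖a k‖ₑ * ENNReal.ofReal (r ^ n k) ≤ C * integralMean p r f := by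
  obtain ⟨N, hN⟩ := h.exists_tsum_ite_add_eq_le hlam
  -- 2N is the constant in the fourth moment bound; the added 1 keeps K positive.
  set K : ℝ := 2 * N + 1 with hK
  have hK0 : 0 < K := by positivity
  have hpi : 0 < 2 * Real.pi := by positivity
  set c := ENNReal.ofReal (1 / (4 * K)) ^ (1 / p.toReal) with hc
  have hc0 : c ≠ 0 := by
    refine (ENNReal.rpow_pos ?_ ENNReal.ofReal_ne_top).ne'
    rw [ENNReal.ofReal_pos]
    positivity
  have hct : c ≠ ∞ := ENNReal.rpow_ne_top_of_nonneg (by positivity) ENNReal.ofReal_ne_top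
  refine ⟨2 * c⁻¹, ENNReal.mul_ne_top (by simp) (ENNReal.inv_ne_top.2 hc0),
    fun f a n hf r hr k => ?_⟩
  set b : ℕ → ℂ := fun k => a k * (r : ℂ) ^ n k with hb
  set g : ℝ → ℂ := fun θ => f (circleMap 0 r θ) with hg
  have hball : ∀ θ, circleMap 0 r θ ∈ Metric.ball (0 : ℂ) 1 := fun θ => by
    simp [abs_of_nonneg hr.1, hr.2]
  have hgc : Continuous g := hf.differentiableOn.continuousOn.comp_continuous
    (continuous_circleMap 0 r) hball
  have hsum : ∀ θ : ℝ, HasSum (fun i => b i * Complex.exp (n i * θ * Complex.I)) (g θ) := by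
    intro θ
    convert hf.hasSum _ (hball θ) using 2 with i
    rw [hb, circleMap_zero, mul_pow, ← Complex.exp_nat_mul]
    ring_nf
  have hbs : Summable fun i => ‖b i‖ := by
    refine (hf.hasSum r ?_).summable.norm
    simp [abs_of_nonneg hr.1, hr.2]
  have hbk : ‖a k‖ₑ * ENNReal.ofReal (r ^ n k) = ‖b k‖ₑ := by
    rw [hb, enorm_mul, enorm_pow, ENNReal.ofReal_pow hr.1, ← ofReal_norm (r : ℂ), Complex.norm_real,
      Real.norm_of_nonneg hr.1]
  rw [hbk]
  rcases eq_or_ne (b k) 0 with hk0 | hk0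
  · simp [hk0]
  have h2 := integral_normSq_of_injective hf.strictMono.injective hbs hsum
  have hbsq : Summable fun i => ‖b i‖ ^ 2 := (summable_mul_right_iff hpi.ne').1 h2.summable
  set A := ∑' i, ‖b i‖ ^ 2 with hA
  have hint2 : ∫ θ in (0 : ℝ)..2 * Real.pi, ‖g θ‖ ^ 2 = 2 * Real.pi * A := by
    rw [← h2.tsum_eq, tsum_mul_right, mul_comm]
  have hkA : ‖b k‖ ^ 2 ≤ A := hbsq.le_tsum k fun _ _ => by positivity
  have hA0 : 0 < A := lt_of_lt_of_le (by positivity) hkA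
  have hAe : ∑' i, ‖b i‖ₑ ^ 2 = ENNReal.ofReal A := by
    rw [hA, ENNReal.ofReal_tsum_of_nonneg (fun _ => by positivity) hbsq]
    congr 1
    ext i
    rw [ENNReal.ofReal_pow (norm_nonneg _), ofReal_norm]
  have hprod : Summable fun x : ℕ × ℕ => ‖b x.1 * b x.2‖ := hbs.mul_norm hbs
  have hsum2 : ∀ θ : ℝ, HasSum (fun x : ℕ × ℕ => b x.1 * b x.2 *
      Complex.exp ((n x.1 + n x.2 : ℕ) * θ * Complex.I)) (g θ ^ 2) := by
    intro θ
    have hs : Summable fun i => ‖b i * Complex.exp (n i * θ * Complex.I)‖ := by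
      simpa only [norm_mul, norm_exp_nat_mul_I, mul_one] using hbs
    have h3 := hasSum_mul_of_summable_norm hs hs (hsum θ) (hsum θ)
    rw [sq]
    convert h3 using 2 with x
    push_cast
    rw [add_mul, add_mul, Complex.exp_add]
    ring
  have h4 := enorm_integral_normSq_le (hN f a n hf) hprod hsum2
  have hprodA : ∑' x : ℕ × ℕ, ‖b x.1 * b x.2‖ₑ ^ 2 = ENNReal.ofReal (A ^ 2) := by
    rw [ENNReal.tsum_prod', ENNReal.ofReal_pow hA0.le, sq (ENNReal.ofReal A), ← hAe,
      ← ENNReal.tsum_mul_right]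
    congr 1
    ext i
    rw [← ENNReal.tsum_mul_left]
    congr 1
    ext j
    rw [enorm_mul, mul_pow]
  have hint4 : ∫ θ in (0 : ℝ)..2 * Real.pi, ‖g θ‖ ^ 4 ≤ 2 * Real.pi * (K * A ^ 2) := by
    have e : ∀ θ, ‖g θ ^ 2‖ ^ 2 = ‖g θ‖ ^ 4 := fun θ => by rw [norm_pow, ← pow_mul]
    simp_rw [e] at h4
    rw [hprodA, show (2 : ℝ≥0∞) * N = ENNReal.ofReal (2 * N) by
      rw [ENNReal.ofReal_mul zero_le_two]; simp, ← ENNReal.ofReal_mul (by positivity),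
      ← ENNReal.ofReal_mul hpi.le, ENNReal.ofReal_le_ofReal_iff (by positivity)] at h4
    refine h4.trans ?_
    gcongr
    rw [hK]
    linarith
  have hvol := le_volume_of_integral_pow_four_le hgc.norm hA0 hK0 hpi hint2 hint4
  -- On this set |b_k|² ≤ A ≤ 2|g|² ≤ (2|g|)², so |g| ≥ |b_k|/2.
  have hge := integralMean_ge (r := r) (f := f) (B := ‖b k‖ₑ / 2) (c := 1 / (4 * K))
    (E := {θ | A / 2 ≤ ‖g θ‖ ^ 2}) hp
    (isClosed_le continuous_const (hgc.norm.pow 2)).measurableSet (by positivity)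
    (fun θ (hθ : A / 2 ≤ ‖g θ‖ ^ 2) => by
      refine ENNReal.div_le_of_le_mul ?_
      rw [← ofReal_norm, ← ofReal_norm, ← ENNReal.ofReal_ofNat 2,
        ← ENNReal.ofReal_mul (norm_nonneg _)]
      refine ENNReal.ofReal_le_ofReal (le_of_sq_le_sq ?_ (by positivity))
      rw [mul_pow]
      change _ ≤ ‖g θ‖ ^ 2 * 2 ^ 2
      linarith) (by
      rwa [mul_one_div])
  calc ‖b k‖ₑ = 2 * c⁻¹ * (‖b k‖ₑ / 2 * c) := by
        rw [show 2 * c⁻¹ * (‖b k‖ₑ / 2 * c) = (2 * (‖b k‖ₑ / 2)) * (c⁻¹ * c) by ring,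
          ENNReal.inv_mul_cancel hc0 hct, mul_one, ENNReal.mul_div_cancel (by simp) (by simp)]
    _ ≤ _ := by gcongr

/-- The bound M_p(r,f) ≳ |a_k| r^{n_k} is used only for r between s_k and s_{k+1}; lacunarity leaves
there a fixed proportion of the mass ω̂(s_k). -/
theorem exists_tailSum_le_mixedNormPow (h : IsDoublingWeight ω β) {p : ℝ≥0∞} (hp : 0 < p)
    {q lam : ℝ} (hq : 0 < q) (hlam : 1 < lam) :
    ∃ C : ℝ≥0∞, C ≠ ∞ ∧ ∀ (f : ℂ → ℂ) (a : ℕ → ℂ) (n : ℕ → ℕ), IsLacunarySeries ω lam f a n →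
      tailSum ω a n q ≤ C * mixedNormPow p q ω f := by
  obtain ⟨C, hC, hcoeff⟩ := h.exists_coeff_le_integralMean hp hlam
  have hl0 : 0 < lam := by linarith
  have hl1 : 1 / lam < 1 := (div_lt_one hl0).2 hlam
  have hl2 : 0 < 1 / lam := by positivity
  -- If n_0 = 1 then s_0 = 0 and r^{n_0} has no lower bound near 0, so every interval is cut at r₀
  -- with ω̂(r₀) = c. As c > 1/lam, the part left still has mass at least (c - 1/lam) ω̂(s_k).
  obtain ⟨c, hc1, hc2⟩ := exists_between hl1
  obtain ⟨r₀, hr₀, hTr₀⟩ := intermediate_value_Icc' zero_le_one h.continuousOn_tailIntegral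
    (show c ∈ Icc (tailIntegral ω 1) (tailIntegral ω 0) by
      rw [tailIntegral_one, h.tailIntegral_zero]; exact ⟨by linarith, hc2.le⟩)
  have hr₀0 : 0 < r₀ := by
    refine lt_of_le_of_ne hr₀.1 fun h0 => ?_
    rw [← h0, h.tailIntegral_zero] at hTr₀
    linarith
  set d := min r₀ (1 / 8) with hd
  have hd0 : 0 < d := by positivity
  have he : 0 < c - 1 / lam := by linarith
  set D := ENNReal.ofReal d ^ q * ENNReal.ofReal (c - 1 / lam) with hD
  have hD0 : D ≠ 0 := by
    refine mul_ne_zero (ENNReal.rpow_pos ?_ ENNReal.ofReal_ne_top).ne' ?_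
    · rwa [ENNReal.ofReal_pos]
    · simpa using he
  have hDt : D ≠ ∞ := ENNReal.mul_ne_top
    (ENNReal.rpow_ne_top_of_nonneg hq.le ENNReal.ofReal_ne_top) ENNReal.ofReal_ne_top
  refine ⟨D⁻¹ * C ^ q, ENNReal.mul_ne_top (ENNReal.inv_ne_top.2 hD0)
    (ENNReal.rpow_ne_top_of_nonneg hq.le hC), fun f a n hf => ?_⟩
  have hs := fun k => one_sub_one_div_mem (hf.one_le k)
  set s : ℕ → ℝ := fun k => 1 - 1 / (n k : ℝ) with hsdef
  have hsmono : Monotone s := by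
    refine monotone_nat_of_le_succ fun k => ?_
    have h0 : 0 < n k := hf.one_le k
    have h1 : n k ≤ n (k + 1) := hf.strictMono.monotone k.le_succ
    simp only [hsdef]
    gcongr
  set E : ℕ → Set ℝ := fun k => Ioo (max (s k) r₀) (s (k + 1)) with hE
  have hEsub : ∀ k, E k ⊆ Ioo (s k) (s (k + 1)) := fun k => Ioo_subset_Ioo_left (le_max_left _ _)
  have hdisj : Pairwise (Function.onFun Disjoint E) := fun i j hij =>
    (hsmono.pairwise_disjoint_on_Ioo_succ hij).mono (hEsub i) (hEsub j)
  have hE01 : (⋃ k, E k) ⊆ Ioo 0 1 := iUnion_subset fun k x hx =>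
    ⟨(hs k).1.trans_lt (hEsub k hx).1, (hEsub k hx).2.trans (hs (k + 1)).2⟩
  have hterm : ∀ k, D * (‖a k‖ₑ ^ q * ENNReal.ofReal (tailIntegral ω (s k))) ≤
      C ^ q * ∫⁻ r in E k, integralMean p r f ^ q * ENNReal.ofReal (ω r) := by
    intro k
    have hTk := h.tailIntegral_pos (hs k)
    have hT1 := h.tailIntegral_le_one (Ico_subset_Icc_self (hs k))
    have hTk1 : tailIntegral ω (s (k + 1)) ≤ 1 / lam * tailIntegral ω (s k) := by
      rw [one_div, le_inv_mul_iff₀ hl0]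
      exact hf.mul_tailIntegral_le h k
    have hle : max (s k) r₀ ≤ s (k + 1) := by
      refine max_le (hsmono k.le_succ) ?_
      refine (h.strictAntiOn_tailIntegral.le_iff_ge (Ico_subset_Icc_self (hs (k + 1))) hr₀).1 ?_
      rw [hTr₀]
      calc _ ≤ 1 / lam * tailIntegral ω (s k) := hTk1
        _ ≤ 1 / lam * 1 := by gcongr
        _ ≤ c := by linarith
    have hmass := h.lintegral_Ioo ((hs k).1.trans (le_max_left _ r₀)) hle (hs (k + 1)).2.le
    have hmax : c * tailIntegral ω (s k) ≤ tailIntegral ω (max (s k) r₀) := by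
      rcases le_total (s k) r₀ with hsr | hsr
      · rw [max_eq_right hsr, hTr₀]
        nlinarith
      · rw [max_eq_left hsr]
        nlinarith
    calc D * (‖a k‖ₑ ^ q * ENNReal.ofReal (tailIntegral ω (s k)))
        = (‖a k‖ₑ * ENNReal.ofReal d) ^ q *
          ENNReal.ofReal ((c - 1 / lam) * tailIntegral ω (s k)) := by
          rw [hD, ENNReal.mul_rpow_of_nonneg _ _ hq.le, ENNReal.ofReal_mul he.le]
          ring
      _ ≤ (‖a k‖ₑ * ENNReal.ofReal d) ^ q * ∫⁻ r in E k, ENNReal.ofReal (ω r) := by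
          rw [hmass]
          gcongr
          linarith
      _ = ∫⁻ r in E k, (‖a k‖ₑ * ENNReal.ofReal d) ^ q * ENNReal.ofReal (ω r) :=
          (lintegral_const_mul' _ _ (ENNReal.rpow_ne_top_of_nonneg hq.le
            (ENNReal.mul_ne_top enorm_ne_top ENNReal.ofReal_ne_top))).symm
      _ ≤ ∫⁻ r in E k, C ^ q * (integralMean p r f ^ q * ENNReal.ofReal (ω r)) := by
          refine setLIntegral_mono' measurableSet_Ioo fun r hr => ?_
          have hr0 : 0 ≤ r := (hs k).1.trans (hEsub k hr).1.le
          have hr1 : r < 1 := (hEsub k hr).2.trans (hs (k + 1)).2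
          rw [← mul_assoc, ← ENNReal.mul_rpow_of_nonneg _ _ hq.le]
          refine mul_le_mul' (ENNReal.rpow_le_rpow ?_ hq.le) le_rfl
          refine le_trans ?_ (hcoeff f a n hf r ⟨hr0, hr1⟩ k)
          gcongr
          rcases Nat.lt_or_ge 1 (n k) with hn | hn
          · calc d ≤ 1 / 8 := min_le_right _ _
              _ ≤ s k ^ n k := one_div_eight_le_pow hn
              _ ≤ r ^ n k := pow_le_pow_left₀ (hs k).1 (hEsub k hr).1.le _
          · have : n k = 1 := le_antisymm hn (hf.one_le k)
            rw [this, pow_one]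
            exact (min_le_left _ _).trans ((le_max_right _ _).trans hr.1.le)
      _ = _ := lintegral_const_mul' _ _ (ENNReal.rpow_ne_top_of_nonneg hq.le hC)
  calc tailSum ω a n q = D⁻¹ * (D * tailSum ω a n q) := by
        rw [← mul_assoc, ENNReal.inv_mul_cancel hD0 hDt, one_mul]
    _ = D⁻¹ * ∑' k, D * (‖a k‖ₑ ^ q * ENNReal.ofReal (tailIntegral ω (s k))) := by
        rw [tailSum, ENNReal.tsum_mul_left]
    _ ≤ D⁻¹ * ∑' k, C ^ q * ∫⁻ r in E k, integralMean p r f ^ q * ENNReal.ofReal (ω r) := by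
        exact mul_le_mul' le_rfl (ENNReal.tsum_le_tsum hterm)
    _ = D⁻¹ * C ^ q * ∫⁻ r in ⋃ k, E k, integralMean p r f ^ q * ENNReal.ofReal (ω r) := by
        rw [ENNReal.tsum_mul_left, lintegral_iUnion (fun k => measurableSet_Ioo) hdisj, mul_assoc]
    _ ≤ _ := by
        gcongr
        exact lintegral_mono_set hE01

end IsDoublingWeight

/-! ### Assembly of the equivalences -/

/-- Both quantities are compared through S. Allowing every C beyond a threshold lets one constant
serve several comparisons at once. -/
lemma exists_comparableWith {ι : Sort*} {P : ι → Prop} {A B S : ι → ℝ≥0∞} {C₁ C₂ C₃ C₄ : ℝ≥0∞}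
    (hC₁ : C₁ ≠ ∞) (hC₂ : C₂ ≠ ∞) (hC₃ : C₃ ≠ ∞) (hC₄ : C₄ ≠ ∞)
    (h₁ : ∀ i, P i → A i ≤ C₁ * S i) (h₂ : ∀ i, P i → S i ≤ C₂ * A i)
    (h₃ : ∀ i, P i → B i ≤ C₃ * S i) (h₄ : ∀ i, P i → S i ≤ C₄ * B i) :
    ∃ C₀ : ℝ, ∀ C, C₀ ≤ C → ∀ i, P i → ComparableWith C (A i) (B i) := by
  refine ⟨max (C₁ * C₄).toReal (C₃ * C₂).toReal, fun C hC i hi => ⟨?_, ?_⟩⟩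
  · calc A i ≤ C₁ * (C₄ * B i) := (h₁ i hi).trans (by gcongr; exact h₄ i hi)
      _ = C₁ * C₄ * B i := (mul_assoc _ _ _).symm
      _ ≤ _ := by
        gcongr
        exact (ENNReal.le_ofReal_iff_toReal_le (ENNReal.mul_ne_top hC₁ hC₄)
          (le_trans (by positivity) hC)).2 ((le_max_left _ _).trans hC)
  · calc B i ≤ C₃ * (C₂ * A i) := (h₃ i hi).trans (by gcongr; exact h₂ i hi)
      _ = C₃ * C₂ * A i := (mul_assoc _ _ _).symm
      _ ≤ _ := by
        gcongr
        exact (ENNReal.le_ofReal_iff_toReal_le (ENNReal.mul_ne_top hC₃ hC₂)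
          (le_trans (by positivity) hC)).2 ((le_max_right _ _).trans hC)

lemma ComparableWith.lt_top_iff {C : ℝ} {A B : ℝ≥0∞} (h : ComparableWith C A B) :
    A < ∞ ↔ B < ∞ :=
  ⟨fun hA => h.2.trans_lt (ENNReal.mul_lt_top ENNReal.ofReal_lt_top hA),
    fun hB => h.1.trans_lt (ENNReal.mul_lt_top ENNReal.ofReal_lt_top hB)⟩

end LacunaryMixedNorm

end

theorem mainTheorem6 (p : ENNReal) (hp : 0 < p) (q α : ℝ) (hq : 0 < q) (hα : 0 < α)
    (ω : ℝ → ℝ)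
    (hω : LacunaryMixedNorm.IsRegularWeight ω ∨ LacunaryMixedNorm.IsRapidlyIncreasingWeight ω)
    (hω1 : ∫ r in (0 : ℝ)..1, ω r = 1) (lam : ℝ) (hlam : 1 < lam) :
    ∃ C : ℝ, 0 < C ∧
      ∀ (f : ℂ → ℂ) (a : ℕ → ℂ) (n : ℕ → ℕ), LacunaryMixedNorm.IsLacunarySeries ω lam f a n →
        List.TFAE
          [ LacunaryMixedNorm.MemMixedNorm p q ω f,
            LacunaryMixedNorm.blockSum ω α a n 2 (q / 2) < ⊤,
            LacunaryMixedNorm.blockSum ω α a n q 1 < ⊤,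
            LacunaryMixedNorm.blockSum ω α a n 1 q < ⊤,
            LacunaryMixedNorm.momentSum ω a n q < ⊤ ] ∧
        LacunaryMixedNorm.ComparableWith C (LacunaryMixedNorm.mixedNormPow p q ω f)
          (LacunaryMixedNorm.blockSum ω α a n 2 (q / 2)) ∧
        LacunaryMixedNorm.ComparableWith C (LacunaryMixedNorm.mixedNormPow p q ω f)
          (LacunaryMixedNorm.blockSum ω α a n q 1) ∧
        LacunaryMixedNorm.ComparableWith C (LacunaryMixedNorm.mixedNormPow p q ω f)
          (LacunaryMixedNorm.blockSum ω α a n 1 q) ∧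
        LacunaryMixedNorm.ComparableWith C (LacunaryMixedNorm.mixedNormPow p q ω f)
          (LacunaryMixedNorm.momentSum ω a n q) := by
  obtain ⟨β, h⟩ : ∃ β, LacunaryMixedNorm.IsDoublingWeight ω β :=
    hω.elim (fun h => h.exists_isDoublingWeight hω1) fun h => h.exists_isDoublingWeight hω1
  obtain ⟨C₁, hC₁, h₁⟩ := h.exists_mixedNormPow_le_tailSum hp hq hlam
  obtain ⟨C₂, hC₂, h₂⟩ := h.exists_tailSum_le_mixedNormPow hp hq hlam
  have key : ∀ B : (ℕ → ℂ) → (ℕ → ℕ) → ENNReal,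
      (∃ C : ENNReal, C ≠ ⊤ ∧ ∀ (f : ℂ → ℂ) (a : ℕ → ℂ) (n : ℕ → ℕ),
        LacunaryMixedNorm.IsLacunarySeries ω lam f a n →
          B a n ≤ C * LacunaryMixedNorm.tailSum ω a n q) →
      (∃ C : ENNReal, C ≠ ⊤ ∧ ∀ (f : ℂ → ℂ) (a : ℕ → ℂ) (n : ℕ → ℕ),
        LacunaryMixedNorm.IsLacunarySeries ω lam f a n →
          LacunaryMixedNorm.tailSum ω a n q ≤ C * B a n) →
      ∃ C₀ : ℝ, ∀ C, C₀ ≤ C → ∀ (f : ℂ → ℂ) (a : ℕ → ℂ) (n : ℕ → ℕ),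
        LacunaryMixedNorm.IsLacunarySeries ω lam f a n →
          LacunaryMixedNorm.ComparableWith C (LacunaryMixedNorm.mixedNormPow p q ω f) (B a n) := by
    rintro B ⟨C₃, hC₃, h₃⟩ ⟨C₄, hC₄, h₄⟩
    obtain ⟨C₀, hC₀⟩ := LacunaryMixedNorm.exists_comparableWith
      (ι := (ℂ → ℂ) × (ℕ → ℂ) × (ℕ → ℕ))
      (P := fun x => LacunaryMixedNorm.IsLacunarySeries ω lam x.1 x.2.1 x.2.2)
      (A := fun x => LacunaryMixedNorm.mixedNormPow p q ω x.1) (B := fun x => B x.2.1 x.2.2)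
      (S := fun x => LacunaryMixedNorm.tailSum ω x.2.1 x.2.2 q) hC₁ hC₂ hC₃ hC₄
      (fun x => h₁ x.1 x.2.1 x.2.2) (fun x => h₂ x.1 x.2.1 x.2.2)
      (fun x => h₃ x.1 x.2.1 x.2.2) (fun x => h₄ x.1 x.2.1 x.2.2)
    exact ⟨C₀, fun C hC f a n => hC₀ C hC (f, a, n)⟩
  have block : ∀ s t : ℝ, 0 < t → s * t = q → _ := fun s t ht hst =>
    key (fun a n => LacunaryMixedNorm.blockSum ω α a n s t)
      (h.exists_blockSum_le_tailSum hα hlam ht hst) (h.exists_tailSum_le_blockSum hα hlam ht hst)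
  obtain ⟨A₂, hA₂⟩ := block 2 (q / 2) (by positivity) (by ring)
  obtain ⟨A₃, hA₃⟩ := block q 1 one_pos (mul_one q)
  obtain ⟨A₄, hA₄⟩ := block 1 q hq (one_mul q)
  obtain ⟨A₅, hA₅⟩ := key (fun a n => LacunaryMixedNorm.momentSum ω a n q)
    (h.exists_momentSum_le_tailSum q lam) (h.exists_tailSum_le_momentSum q lam)
  -- A positive number beyond all four thresholds, whose signs are unknown.
  refine ⟨|A₂| + |A₃| + |A₄| + |A₅| + 1, by positivity, fun f a n hf => ?_⟩
  have b₂ := abs_nonneg A₂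
  have b₃ := abs_nonneg A₃
  have b₄ := abs_nonneg A₄
  have b₅ := abs_nonneg A₅
  have c₂ := hA₂ (|A₂| + |A₃| + |A₄| + |A₅| + 1) (by linarith [le_abs_self A₂]) f a n hf
  have c₃ := hA₃ (|A₂| + |A₃| + |A₄| + |A₅| + 1) (by linarith [le_abs_self A₃]) f a n hf
  have c₄ := hA₄ (|A₂| + |A₃| + |A₄| + |A₅| + 1) (by linarith [le_abs_self A₄]) f a n hf
  have c₅ := hA₅ (|A₂| + |A₃| + |A₄| + |A₅| + 1) (by linarith [le_abs_self A₅]) f a n hf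
  refine ⟨?_, c₂, c₃, c₄, c₅⟩
  have hmem : LacunaryMixedNorm.MemMixedNorm p q ω f ↔
      LacunaryMixedNorm.mixedNormPow p q ω f < ⊤ :=
    and_iff_right hf.differentiableOn
  rw [hmem]
  tfae_have 1 ↔ 2 := c₂.lt_top_iff
  tfae_have 1 ↔ 3 := c₃.lt_top_iff
  tfae_have 1 ↔ 4 := c₄.lt_top_iff
  tfae_have 1 ↔ 5 := c₅.lt_top_iff
  tfae_finish
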